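/- **Setting.** Let $\mathcal M$ be a finite set of models for $n\ge 1$ fixed observations $\mathbf y$. Model $\mathfrak m$ has parameter space $\mathbb R^{d_{\mathfrak m}}$, log-likelihood $\ell_{\mathfrak m}(\theta)=\ln p(\mathbf y\mid\theta,\mathfrak m)$, a positive prior density $p(\theta\mid\mathfrak m)$ and a prior probability $p(\mathfrak m)>0$, with $\sum_{\mathfrak m}p(\mathfrak m)=1$. Put $$\tilde p(\mathbf y\mid\theta,\mathfrak m)=\exp\!\Big(\ell_{\mathfrak m}(\theta)-\tfrac{d_{\mathfrak m}}2\ln n\Big),\qquad \hat p(\mathbf y\mid\mathfrak m)=\tilde p(\mathbf y\mid\hat\theta_{\mathfrak m},\mathfrak m),$$ where $\hat\theta_{\mathfrak m}$ is the maximum likelihood estimate; $\hat p(\mathbf y\mid\mathfrak m)$ is the Laplace approximation of the marginal likelihood $p(\mathbf y\mid\mathfrak m)=\int p(\mathbf y\mid\theta,\mathfrak m)\,p(\theta\mid\mathfrak m)\,d\theta$. Let $p_L(\mathbf y\mid\mathfrak m)=p(\mathbf y\mid\mathfrak m)$ for the models for which the exact marginal likelihood is available, and it is assumed that for these the Laplace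 approximation is exact, $\hat p(\mathbf y\mid\mathfrak m)=p(\mathbf y\mid\mathfrak m)$; for the other models let $p_L(\mathbf y\mid\mathfrak m)=\hat p(\mathbf y\mid\mathfrak m)$. The target is $\pi(\mathfrak m)=p_L(\mathbf y\mid\mathfrak m)p(\mathfrak m)\big/\sum_{\mathfrak m'}p_L(\mathbf y\mid\mathfrak m')p(\mathfrak m')$. **Algorithm (MCMC with BSGD).** Choose a finite mixture, with weights $\rho_r$, of proposal kernels $q_r(\mathfrak m^\star\mid\mathfrak m)$, such that some $q_{r'}$ with $\rho_{r'}>0$ satisfies $q_{r'}(\mathfrak m^\star\mid\mathfrak m)>0$ for all $\mathfrak m,\mathfrak m^\star$; further a number $\epsilon$ with $0<\epsilon\le\min_{\mathfrak m}\hat p(\mathbf y\mid\mathfrak m)$, a probability $p_{\rm rand}\in[0,1]$, a standard deviation $\sigma_{\rm rand}\ge0$, and an integer $U\ge1$. Start at some model, with $\hat p^{\,{\rm opt},0}(\mathbf y\mid\mathfrak m)=\epsilon$ for all $\mathfrak m$. In iteration $s=1,2,\dots$, from the current model $\mathfrak m$: 1. Draw $r$ with probability $\rho_r$ and then a proposal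 $\mathfrak m^\star\sim q_r(\cdot\mid\mathfrak m)$. This is a *visit* of $\mathfrak m^\star$. 2. Run at least one and at most $U$ BSGD iterations $\theta\leftarrow\theta+\alpha_{\mathfrak m^\star,\tau}V_{\mathfrak m^\star}(\theta;w_{\mathfrak m^\star,\tau})$ (the number may be random), where $\tau=1,2,\dots$ counts the BSGD iterations made for $\mathfrak m^\star$ over all visits. The first visit starts from an arbitrary random point independent of the oracle's randomness; every revisit starts from the point where BSGD ended at the previous visit of $\mathfrak m^\star$, and continues the counter $\tau$ and so the step-size sequence. For each model the $w_{\mathfrak m,\tau}$, $\tau\ge1$, are i.i.d. 3. Let $\theta_s$ be the point where BSGD ended; with probability $p_{\rm rand}$ add to it an independent $N(0,\sigma_{\rm rand}^2I)$ vector (only for step 4, not for later restarts). 4. Set $\hat p^{\,{\rm opt},s}(\mathbf y\mid\mathfrak m^\star)=\max\big(\hat p^{\,{\rm opt},s-1}(\mathbf y\mid\mathfrak m^\star),\tilde p(\mathbf y\mid\theta_s,\mathfrak m^\star)\big)$, and keep the values of the other models. 5. Move to $\mathfrak m^\star$ with probability $\min\Big\{1,\dfrac{\hat p^{\,{\rm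 opt},s}(\mathbf y\mid\mathfrak m^\star)\,p(\mathfrak m^\star)\,q_r(\mathfrak m\mid\mathfrak m^\star)}{\hat p^{\,{\rm opt},s}(\mathbf y\mid\mathfrak m)\,p(\mathfrak m)\,q_r(\mathfrak m^\star\mid\mathfrak m)}\Big\}$, and stay at $\mathfrak m$ otherwise. The renormalised estimate after $t$ iterations is $$\hat p^{(t)}_{RM}(\mathfrak m\mid\mathbf y)=\frac{\hat p^{\,{\rm opt},t}(\mathbf y\mid\mathfrak m)\,p(\mathfrak m)}{\sum_{\mathfrak m'\in\mathcal M_V^{(t)}}\hat p^{\,{\rm opt},t}(\mathbf y\mid\mathfrak m')\,p(\mathfrak m')}\,\mathbb 1\big(\mathfrak m\in\mathcal M_V^{(t)}\big),$$ where $\mathcal M^{(t)}_V$ is the set of models occupied by the chain in iterations $1,\dots,t$ or, alternatively, the set of models proposed in these iterations. **Theorem.** Assume that the following holds for every $\mathfrak m\in\mathcal M$ (all constants may depend on $\mathfrak m$). 1. $\ell_{\mathfrak m}$ is differentiable, and $\ell_{\mathfrak m}$ and $\nabla\ell_{\mathfrak m}$ are Lipschitz continuous. 2. $\ell_{\mathfrak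 m}$ is strictly concave. 3. $-\ell_{\mathfrak m}$ is coercive: $-\ell_{\mathfrak m}(\theta)\to\infty$ as $\|\theta\|\to\infty$. 4. $\liminf_{\|\theta\|\to\infty}\|\nabla\ell_{\mathfrak m}(\theta)\|>0$. 5. $V_{\mathfrak m}(\theta;w)=\nabla\ell_{\mathfrak m}(\theta)+Z_{\mathfrak m}(\theta;w)$ with $E\,Z_{\mathfrak m}(\theta;w)=0$ and $E\|Z_{\mathfrak m}(\theta;w)\|^{q}\le\sigma^{q}$ for all $\theta$, for some $q\ge2$ and $\sigma\ge0$. Assume also that the step sizes are positive and $\alpha_{\mathfrak m,\tau}=\Theta(1/\tau^{l})$ as $\tau\to\infty$ for some $l\in(2/(q+2),1]$. Then, for every $\mathfrak m\in\mathcal M$, as $t\to\infty$, $$\hat p^{\,{\rm opt},t}(\mathbf y\mid\mathfrak m)\xrightarrow{\ a.s.\ }p_L(\mathbf y\mid\mathfrak m)\qquad\text{and}\qquad \hat p^{(t)}_{RM}(\mathfrak m\mid\mathbf y)\xrightarrow{\ a.s.\ }\pi(\mathfrak m),$$ the latter for both choices of $\mathcal M_V^{(t)}$. -/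

import Mathlib

open Filter MeasureTheory ProbabilityTheory Topology Asymptotics
open scoped ENNReal NNReal

noncomputable section

/-- A finite class of Bayesian models for `n` fixed observations. Model `m` has parameter space
`ℝ^(dim m)`, log-likelihood `θ ↦ ln p(y | θ, m)`, a positive prior density `p(θ | m)` and a positive
prior probability `p(m)`. -/
structure ModelClass (M : Type*) [Fintype M] where
  n : ℕ
  n_pos : 0 < n
  dim : M → ℕ
  logLik : ∀ m, EuclideanSpace ℝ (Fin (dim m)) → ℝ
  paramPrior : ∀ m, EuclideanSpace ℝ (Fin (dim m)) → ℝ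
  paramPrior_pos : ∀ m θ, 0 < paramPrior m θ
  integral_paramPrior : ∀ m, ∫ θ, paramPrior m θ = 1
  modelPrior : M → ℝ
  modelPrior_pos : ∀ m, 0 < modelPrior m
  sum_modelPrior : ∑ m, modelPrior m = 1

namespace ModelClass

variable {M : Type*} [Fintype M] (𝓜 : ModelClass M)

/-- The parameter space of model `m`. -/
abbrev Param (m : M) : Type := EuclideanSpace ℝ (Fin (𝓜.dim m))

/-- The maximum likelihood estimate: a global maximiser of the log-likelihood
(see `logLik_le_logLik_mle` for its existence). -/
def mle (m : M) : 𝓜.Param m :=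
  Classical.epsilon fun θ => ∀ θ', 𝓜.logLik m θ' ≤ 𝓜.logLik m θ

/-- The plug-in estimate `exp (ln p(y | θ, m) - (|θ_m| / 2) ln n)` of the marginal likelihood. -/
def plugIn (m : M) (θ : 𝓜.Param m) : ℝ :=
  Real.exp (𝓜.logLik m θ - (𝓜.dim m : ℝ) / 2 * Real.log 𝓜.n)

/-- The Laplace approximation `p̂(y | m)`: the plug-in estimate at the maximum likelihood
estimate. -/
def laplace (m : M) : ℝ := 𝓜.plugIn m (𝓜.mle m)

/-- The exact marginal likelihood `p(y | m) = ∫ p(y | θ, m) p(θ | m) dθ`. -/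
def marginal (m : M) : ℝ := ∫ θ, Real.exp (𝓜.logLik m θ) * 𝓜.paramPrior m θ

open Classical in
/-- The target marginal likelihood `p_L(y | m)`: the exact one for the models for which it is
available, the Laplace approximation for the others. -/
def pL (available : Set M) (m : M) : ℝ :=
  if m ∈ available then 𝓜.marginal m else 𝓜.laplace m

/-- The target model probability `π(m)`. -/
def target (available : Set M) (m : M) : ℝ :=
  𝓜.pL available m * 𝓜.modelPrior m / ∑ m', 𝓜.pL available m' * 𝓜.modelPrior m'

/-- The renormalised estimate of the probability of `m` when `V` is the set of visited models and
`p m'` is the current estimate of the marginal likelihood of `m'`. -/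
def renormalised [DecidableEq M] (p : M → ℝ) (V : Finset M) (m : M) : ℝ :=
  if m ∈ V then p m * 𝓜.modelPrior m / ∑ m' ∈ V, p m' * 𝓜.modelPrior m' else 0

end ModelClass

section Conditions

variable {E : Type*} [NormedAddCommGroup E] [InnerProductSpace ℝ E] [CompleteSpace E]

/-- The log-likelihood and its gradient are Lipschitz continuous. -/
def LipschitzLogLik (l : E → ℝ) : Prop :=
  (∃ G : ℝ≥0, 0 < G ∧ LipschitzWith G l) ∧
    Differentiable ℝ l ∧ ∃ L : ℝ≥0, 0 < L ∧ LipschitzWith L (gradient l)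

/-- The log-likelihood is strictly concave. -/
def StrictlyConcaveLogLik (l : E → ℝ) : Prop := StrictConcaveOn ℝ Set.univ l

/-- The negative log-likelihood is coercive. -/
def CoerciveLogLik (l : E → ℝ) : Prop :=
  Tendsto (fun θ => - l θ) (Bornology.cobounded E) atTop

/-- Asymptotic flatness, in the sense that the gradient of the negative log-likelihood is bounded
away from zero at infinity. -/
def AsymptoticallyFlatLogLik (l : E → ℝ) : Prop :=
  0 < liminf (fun θ => ‖gradient (fun θ' => - l θ') θ‖ₑ) (Bornology.cobounded E)

/-- `V(θ; w)`, with `w` distributed as `ν`, is an unbiased stochastic first order oracle for the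
gradient of `l`, and its error has uniformly bounded `q`-th moments. -/
def StochasticOracle [MeasurableSpace E] {W : Type*} [MeasurableSpace W] (l : E → ℝ)
    (ν : Measure W) (V : E → W → E) (q : ℝ) : Prop :=
  2 ≤ q ∧ Measurable (Function.uncurry V) ∧ ∃ σ : ℝ, 0 ≤ σ ∧ ∀ θ,
    ∫ w, (V θ w - gradient l θ) ∂ν = 0 ∧
    Integrable (fun w => ‖V θ w - gradient l θ‖ ^ q) ν ∧
    ∫ w, ‖V θ w - gradient l θ‖ ^ q ∂ν ≤ σ ^ q

end Conditions

/-- Under Lipschitz continuity and coercivity, `mle` is a genuine global maximiser. -/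
theorem ModelClass.logLik_le_logLik_mle {M : Type*} [Fintype M] (𝓜 : ModelClass M) (m : M)
    (h₁ : LipschitzLogLik (𝓜.logLik m)) (h₃ : CoerciveLogLik (𝓜.logLik m)) (θ : 𝓜.Param m) :
    𝓜.logLik m θ ≤ 𝓜.logLik m (𝓜.mle m) := by
  obtain ⟨⟨G, -, hG⟩, -⟩ := h₁
  have hc : Tendsto (fun θ => - 𝓜.logLik m θ) (cocompact (𝓜.Param m)) atTop := by
    rw [← Metric.cobounded_eq_cocompact]; exact h₃
  obtain ⟨x, hx⟩ := hG.continuous.neg.exists_forall_le hc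
  have hex : ∃ x, ∀ θ', 𝓜.logLik m θ' ≤ 𝓜.logLik m x := ⟨x, fun θ' => neg_le_neg_iff.mp (hx θ')⟩
  exact Classical.epsilon_spec hex θ

/-- `k` iterations of (batch) stochastic gradient ascent on the log-likelihood, started at `θ` when
`τ` iterations have been made before: iteration number `τ + i` uses the step size `α (τ + i)` and
the oracle call `w (τ + i)`. -/
def bsgd {E W : Type*} [AddCommGroup E] [Module ℝ E] (α : ℕ → ℝ) (V : E → W → E) (w : ℕ → W)
    (τ : ℕ) (θ : E) : ℕ → E
  | 0 => θ
  | k + 1 =>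
    bsgd α V w τ θ k + α (τ + k + 1) • V (bsgd α V w τ θ k) (w (τ + k + 1))

/-- The ingredients of the algorithm: a mixture of proposal kernels, `kernel r m m'` being
`q_r(m' | m)`, the gradient oracles, the step sizes, the initial value `eps` of all estimates of
marginal likelihoods, the probability and the standard deviation of the final Gaussian
randomisation, and the maximal number of BSGD iterations per visit. -/
structure Algorithm {M : Type*} [Fintype M] (𝓜 : ModelClass M) (W : M → Type*)
    (ι : Type*) [Fintype ι] where
  weight : ι → ℝ
  weight_nonneg : ∀ r, 0 ≤ weight r
  sum_weight : ∑ r, weight r = 1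
  kernel : ι → M → M → ℝ
  kernel_nonneg : ∀ r m m', 0 ≤ kernel r m m'
  sum_kernel : ∀ r m, ∑ m', kernel r m m' = 1
  oracle : ∀ m, 𝓜.Param m → W m → 𝓜.Param m
  stepSize : M → ℕ → ℝ
  stepSize_pos : ∀ m τ, 1 ≤ τ → 0 < stepSize m τ
  eps : ℝ
  pRand : ℝ
  sdRand : ℝ≥0
  maxIter : ℕ

/-- The random inputs of the algorithm. `seed m τ` is the randomness of the `τ`-th oracle call made
for model `m` (counted from `1`, over all visits of `m`); the inputs with index `s` are those of
iteration `s + 1`. -/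
structure Inputs {M : Type*} [Fintype M] (𝓜 : ModelClass M) (W : M → Type*) (ι Ω : Type*) where
  initModel : Ω → M
  initParam : ∀ m, Ω → 𝓜.Param m
  seed : ∀ m, ℕ → Ω → W m
  /-- index of the proposal kernel that is used -/
  kernelIdx : ℕ → Ω → ι
  /-- proposed model -/
  proposal : ℕ → Ω → M
  /-- number of BSGD iterations made for the proposed model -/
  iters : ℕ → Ω → ℕ
  /-- whether the result of BSGD is randomised -/
  randomise : ℕ → Ω → Bool
  /-- standard Gaussian vector used for that randomisation -/
  noise : ℕ → ∀ m, Ω → 𝓜.Param m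
  /-- uniform variable that decides about acceptance -/
  unif : ℕ → Ω → ℝ

/-- What the algorithm remembers: the current model and, for every model, the point where its last
BSGD run ended, the number of BSGD iterations made so far (hence the position in the step-size
sequence) and the best estimate of the marginal likelihood so far. -/
structure AlgState {M : Type*} [Fintype M] (𝓜 : ModelClass M) where
  current : M
  param : ∀ m, 𝓜.Param m
  count : M → ℕ
  popt : M → ℝ

namespace Algorithm

variable {M : Type*} [Fintype M] [DecidableEq M] {𝓜 : ModelClass M} {W : M → Type*}
  {ι : Type*} [Fintype ι] {Ω : Type*}

/-- Metropolis–Hastings acceptance probability of a move from `m` to `m'` proposed by kernel `r`,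
when `p` holds the current estimates of the marginal likelihoods. -/
def acceptProb (A : Algorithm 𝓜 W ι) (p : M → ℝ) (r : ι) (m m' : M) : ℝ :=
  min 1 ((p m' * 𝓜.modelPrior m' * A.kernel r m' m) / (p m * 𝓜.modelPrior m * A.kernel r m m'))

/-- The outcome of BSGD for the model proposed in iteration `s + 1`, resumed from state `S`. -/
def bsgdResult (A : Algorithm 𝓜 W ι) (I : Inputs 𝓜 W ι Ω) (s : ℕ) (ω : Ω) (S : AlgState 𝓜) :
    𝓜.Param (I.proposal s ω) :=
  bsgd (A.stepSize (I.proposal s ω)) (A.oracle (I.proposal s ω))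
    (fun τ => I.seed (I.proposal s ω) τ ω) (S.count (I.proposal s ω))
    (S.param (I.proposal s ω)) (I.iters s ω)

/-- The point at which the marginal likelihood of the proposed model is evaluated: the outcome of
BSGD, possibly randomised. -/
def evalPoint (A : Algorithm 𝓜 W ι) (I : Inputs 𝓜 W ι Ω) (s : ℕ) (ω : Ω) (S : AlgState 𝓜) :
    𝓜.Param (I.proposal s ω) :=
  if I.randomise s ω then
    A.bsgdResult I s ω S + (A.sdRand : ℝ) • I.noise s (I.proposal s ω) ω
  else A.bsgdResult I s ω S

/-- The running maxima after iteration `s + 1`. -/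
def newPopt (A : Algorithm 𝓜 W ι) (I : Inputs 𝓜 W ι Ω) (s : ℕ) (ω : Ω) (S : AlgState 𝓜) : M → ℝ :=
  Function.update S.popt (I.proposal s ω)
    (max (S.popt (I.proposal s ω)) (𝓜.plugIn (I.proposal s ω) (A.evalPoint I s ω S)))

/-- Iteration `s + 1` of the algorithm. -/
def step (A : Algorithm 𝓜 W ι) (I : Inputs 𝓜 W ι Ω) (s : ℕ) (ω : Ω) (S : AlgState 𝓜) :
    AlgState 𝓜 where
  current :=
    if I.unif s ω ≤ A.acceptProb (A.newPopt I s ω S) (I.kernelIdx s ω) S.current (I.proposal s ω)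
    then I.proposal s ω else S.current
  param := Function.update S.param (I.proposal s ω) (A.bsgdResult I s ω S)
  count := Function.update S.count (I.proposal s ω) (S.count (I.proposal s ω) + I.iters s ω)
  popt := A.newPopt I s ω S

/-- The state after `s` iterations. -/
def run (A : Algorithm 𝓜 W ι) (I : Inputs 𝓜 W ι Ω) : ℕ → Ω → AlgState 𝓜
  | 0, ω =>
    { current := I.initModel ω
      param := fun m => I.initParam m ω
      count := fun _ => 0
      popt := fun _ => A.eps }
  | s + 1, ω => A.step I s ω (A.run I s ω)

/-- The models occupied by the chain in iterations `1, …, t`. -/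
def occupied (A : Algorithm 𝓜 W ι) (I : Inputs 𝓜 W ι Ω) (t : ℕ) (ω : Ω) : Finset M :=
  (Finset.Icc 1 t).image fun s => (A.run I s ω).current

/-- The models evaluated (that is, proposed) in iterations `1, …, t`. -/
def evaluated (I : Inputs 𝓜 W ι Ω) (t : ℕ) (ω : Ω) : Finset M :=
  (Finset.range t).image fun s => I.proposal s ω

/-- The random inputs have the joint behaviour that the algorithm prescribes. The σ-algebra `𝓕 s`
stands for the history of the first `s` iterations, and `𝓖 s` for that history together with the
proposal and the BSGD run of iteration `s + 1`; `ν m` is the law of the oracle seeds for `m`. -/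
structure IsRun (A : Algorithm 𝓜 W ι) (I : Inputs 𝓜 W ι Ω) [∀ m, MeasurableSpace (W m)]
    (ν : ∀ m, Measure (W m)) [mΩ : MeasurableSpace Ω] (P : Measure Ω)
    (𝓕 : Filtration ℕ mΩ) (𝓖 : ℕ → MeasurableSpace Ω) : Prop where
  le_𝓖 : ∀ s, 𝓕 s ≤ 𝓖 s
  𝓖_le : ∀ s, 𝓖 s ≤ 𝓕 (s + 1)
  measurable_initModel : ∀ m, MeasurableSet[𝓕 0] {ω | I.initModel ω = m}
  measurable_initParam : ∀ m, Measurable[𝓕 0] (I.initParam m)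
  measurable_kernelIdx : ∀ s r, MeasurableSet[𝓖 s] {ω | I.kernelIdx s ω = r}
  measurable_proposal : ∀ s m, MeasurableSet[𝓖 s] {ω | I.proposal s ω = m}
  measurable_iters : ∀ s k, MeasurableSet[𝓖 s] {ω | I.iters s ω = k}
  measurable_param : ∀ s m, Measurable[𝓖 s] fun ω => (A.run I (s + 1) ω).param m
  measurable_randomise : ∀ s, Measurable[𝓕 (s + 1)] (I.randomise s)
  measurable_noise : ∀ s m, Measurable[𝓕 (s + 1)] (I.noise s m)
  measurable_unif : ∀ s, Measurable[𝓕 (s + 1)] (I.unif s)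
  /-- the oracle calls for a model are i.i.d. and independent of its starting point -/
  seed_law : ∀ m τ, HasLaw (I.seed m τ) (ν m) P
  measurable_seed : ∀ m τ, Measurable (I.seed m τ)
  seed_indep : ∀ m, iIndepFun (I.seed m) P
  seed_indep_initParam : ∀ m, IndepFun (I.initParam m) (fun ω τ => I.seed m τ ω) P
  /-- given the past, a kernel is drawn from the mixture and a model from that kernel -/
  proposal_law : ∀ s r m, P⟦{ω | I.kernelIdx s ω = r ∧ I.proposal s ω = m} | 𝓕 s⟧ =ᵐ[P]
    fun ω => A.weight r * A.kernel r (A.run I s ω).current m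
  /-- every visit makes at least one and at most `maxIter` iterations of BSGD -/
  one_le_iters : ∀ s ω, 1 ≤ I.iters s ω
  iters_le : ∀ s ω, I.iters s ω ≤ A.maxIter
  randomise_law : ∀ s, P.real {ω | I.randomise s ω = true} = A.pRand
  noise_law : ∀ s m, HasLaw (I.noise s m) (stdGaussian (𝓜.Param m)) P
  unif_law : ∀ s, HasLaw (I.unif s) (volume.restrict (Set.Icc (0 : ℝ) 1)) P
  /-- randomisation and acceptance use fresh, mutually independent variables -/
  aux_indep : ∀ s, iIndep ![𝓖 s, MeasurableSpace.comap (I.randomise s) inferInstance,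
    MeasurableSpace.comap (fun ω m => I.noise s m ω) inferInstance,
    MeasurableSpace.comap (I.unif s) inferInstance] P

end Algorithm

end

/-!
The proof has a stochastic part, which shows that the gradient ascent of every model converges to its
maximum likelihood estimate, and a recurrence part, which shows that the chain of models keeps feeding
the gradient ascents and finally occupies every model.

Let `z` maximise the log-likelihood and let `g` be the distance to the ball of radius `r` around `z`.
Strict concavity gives a radial drift towards `z` that is bounded away from zero outside this ball
(`exists_inner_gradient_le`). As `g` vanishes inside the ball, a Taylor bound for `g ^ q`
(`exists_norm_add_rpow_le`, `norm_overshoot_add_le`) shows that a step of size `α` changes `g ^ q` in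
conditional mean by at most `-c α g ^ (q - 1) + C α ^ q`
(`StochasticOracle.exists_integral_norm_overshoot_rpow_le`): the second order term
`α ^ 2 g ^ (q - 2)` is absorbed by the drift unless `g` is of the order of `α`. Hence the step sizes
need only have summable `q`-th powers, and `l q > 1` follows from `l > 2 / (q + 2)` and `q ≥ 2`. By the
Robbins–Siegmund theorem `g ^ q` converges almost surely and `∑ α g ^ (q - 1)` is finite; the step
sizes have an infinite sum, so the limit is zero. Letting `r` tend to zero gives
`StochasticOracle.ae_tendsto_bsgd`.

Since every visit resumes from the end of the last one, the points at which the visits of a model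
end lie on a single trajectory of gradient ascent (`Algorithm.run_param_eq_bsgd`), and they converge
to `z` if the model is proposed infinitely often. This follows from Lévy's extension of the
Borel–Cantelli lemma (`Algorithm.IsRun.ae_frequently_proposal`), also jointly with a small noise
vector or with a small uniform variable. Visits with small noise let the running maximum reach its
upper bound, the Laplace approximation (`Algorithm.tendsto_run_popt`). Small uniform variables force
acceptance, because the estimates and therefore the acceptance probabilities are bounded away from
zero (`Algorithm.exists_le_acceptProb`). So every model is eventually among the visited ones, and the
renormalised estimates converge.
-/

/-! ### Powers of the distance to a ball, and the drift of the gradient -/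

section Analysis

variable {E : Type*} [NormedAddCommGroup E] [InnerProductSpace ℝ E]

open scoped RealInnerProductSpace

/-- A second order Taylor bound for `‖·‖ ^ q`, with an error term that remains valid for increments
that are large compared with `y`. -/
theorem exists_norm_add_rpow_le {q : ℝ} (hq : 2 ≤ q) :
    ∃ C, 0 ≤ C ∧ ∀ y h : E, ‖y + h‖ ^ q ≤
      ‖y‖ ^ q + q * ‖y‖ ^ (q - 2) * ⟪y, h⟫ + C * (‖y‖ ^ (q - 2) * ‖h‖ ^ 2 + ‖h‖ ^ q) := by
  -- For `‖h‖ < ‖y‖ / K` the relative increment `t` of `‖y‖ ^ 2` satisfies `|q / 2 * t| ≤ 1`, so that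
  -- `(1 + t) ^ (q / 2) ≤ exp (q / 2 * t)` can be expanded; for larger `h` the error term dominates.
  set K : ℝ := 3 * (q / 2) with hK
  refine ⟨(K + 1) ^ q + q * K + (q / 2 + 9 * (q / 2) ^ 2), by positivity, fun y h => ?_⟩
  have hin : |⟪y, h⟫| ≤ ‖y‖ * ‖h‖ := abs_real_inner_le_norm y h
  have hA : 0 ≤ ‖y‖ ^ (q - 2) := by positivity
  have hB : 0 ≤ ‖h‖ ^ q := by positivity
  have hC : 0 ≤ ‖y‖ ^ q := by positivity
  have hD : 0 ≤ (K + 1) ^ q := by positivity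
  rcases le_or_gt ‖y‖ (K * ‖h‖) with hle | hlt
  · have h1 : ‖y + h‖ ^ q ≤ (K + 1) ^ q * ‖h‖ ^ q := by
      rw [← Real.mul_rpow (by positivity) (by positivity)]
      refine Real.rpow_le_rpow (by positivity) ?_ (by positivity)
      linarith [norm_add_le y h]
    have h2 : -(‖y‖ ^ (q - 2) * (K * ‖h‖ ^ 2)) ≤ ‖y‖ ^ (q - 2) * ⟪y, h⟫ := by
      rw [← mul_neg]
      refine mul_le_mul_of_nonneg_left ?_ hA
      have : ‖y‖ * ‖h‖ ≤ K * ‖h‖ * ‖h‖ := by gcongr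
      nlinarith [neg_abs_le ⟪y, h⟫]
    have h3 : 0 ≤ ‖y‖ ^ (q - 2) * ‖h‖ ^ 2 := by positivity
    have h4 : 0 ≤ (K + 1) ^ q * (‖y‖ ^ (q - 2) * ‖h‖ ^ 2) := by positivity
    have h5 : 0 ≤ (q / 2 + 9 * (q / 2) ^ 2) * (‖y‖ ^ (q - 2) * ‖h‖ ^ 2 + ‖h‖ ^ q) := by positivity
    have h6 : 0 ≤ q * K * ‖h‖ ^ q := by positivity
    nlinarith [mul_le_mul_of_nonneg_left h2 (by linarith : (0 : ℝ) ≤ q)]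
  · have hy : 0 < ‖y‖ := lt_of_le_of_lt (by positivity) hlt
    set s : ℝ := 2 * ⟪y, h⟫ + ‖h‖ ^ 2 with hs
    have hKh : ‖h‖ ≤ ‖y‖ := by nlinarith [norm_nonneg h]
    have hs_le : |s| ≤ 3 * (‖y‖ * ‖h‖) := by
      have : ‖h‖ ^ 2 ≤ ‖y‖ * ‖h‖ := by nlinarith [norm_nonneg h]
      rw [abs_le] at hin ⊢
      constructor <;> nlinarith [sq_nonneg ‖h‖]
    set t : ℝ := s / ‖y‖ ^ 2 with ht
    have hst : ‖y‖ ^ 2 * t = s := by rw [ht]; field_simp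
    have hexp : ‖y + h‖ ^ 2 = ‖y‖ ^ 2 * (1 + t) := by
      rw [norm_add_sq_real, mul_add, hst, hs]; ring
    have h1t : 0 ≤ 1 + t := by
      have : 0 ≤ ‖y‖ ^ 2 * (1 + t) := by rw [← hexp]; positivity
      exact nonneg_of_mul_nonneg_right this (by positivity)
    have hpt : |q / 2 * t| ≤ 1 := by
      rw [ht, abs_mul, abs_div s, abs_of_nonneg (by positivity : (0 : ℝ) ≤ q / 2),
        abs_of_nonneg (by positivity : 0 ≤ ‖y‖ ^ 2), mul_div_assoc', div_le_one (by positivity)]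
      calc q / 2 * |s| ≤ q / 2 * (3 * (‖y‖ * ‖h‖)) := by gcongr
        _ = ‖y‖ * (K * ‖h‖) := by rw [hK]; ring
        _ ≤ ‖y‖ * ‖y‖ := by gcongr
        _ = ‖y‖ ^ 2 := by ring
    have hpow : ∀ a : ℝ, 0 ≤ a → a ^ q = (a ^ 2) ^ (q / 2) := fun a ha => by
      rw [← Real.rpow_natCast a 2, ← Real.rpow_mul ha]; congr 1; push_cast; ring
    have hq2 : ‖y‖ ^ q = ‖y‖ ^ (q - 2) * ‖y‖ ^ 2 := by
      rw [← Real.rpow_natCast ‖y‖ 2, ← Real.rpow_add hy]; congr 1; push_cast; ring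
    have hmain : ‖y + h‖ ^ q ≤ ‖y‖ ^ q * (1 + q / 2 * t + (q / 2 * t) ^ 2) := by
      rw [hpow _ (norm_nonneg _), hexp, Real.mul_rpow (by positivity) h1t, ← hpow _ (norm_nonneg _)]
      gcongr
      calc (1 + t) ^ (q / 2) ≤ (Real.exp t) ^ (q / 2) := by
            gcongr; linarith [Real.add_one_le_exp t]
        _ = Real.exp (q / 2 * t) := by rw [← Real.exp_mul, mul_comm]
        _ ≤ _ := by linarith [(abs_le.1 (Real.abs_exp_sub_one_sub_id_le hpt)).2]
    have hsq : ‖y‖ ^ q * t ^ 2 ≤ ‖y‖ ^ (q - 2) * (9 * ‖h‖ ^ 2) := by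
      have h1 : ‖y‖ ^ 2 * t ^ 2 ≤ 9 * ‖h‖ ^ 2 := by
        have h2 : s ^ 2 ≤ (3 * (‖y‖ * ‖h‖)) ^ 2 := by
          rw [← sq_abs]; gcongr
        have h3 : ‖y‖ ^ 2 * (‖y‖ ^ 2 * t ^ 2) ≤ ‖y‖ ^ 2 * (9 * ‖h‖ ^ 2) := by
          have : ‖y‖ ^ 2 * (‖y‖ ^ 2 * t ^ 2) = s ^ 2 := by rw [← hst]; ring
          rw [this]; nlinarith
        exact le_of_mul_le_mul_left h3 (by positivity)
      rw [hq2, mul_assoc]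
      gcongr
    have hlin : ‖y‖ ^ q * t = ‖y‖ ^ (q - 2) * s := by rw [hq2, mul_assoc, hst]
    have h3 : 0 ≤ ‖y‖ ^ (q - 2) * ‖h‖ ^ 2 := by positivity
    have h4 : 0 ≤ ((K + 1) ^ q + q * K) * (‖y‖ ^ (q - 2) * ‖h‖ ^ 2 + ‖h‖ ^ q) := by positivity
    have h5 : 0 ≤ (q / 2 + 9 * (q / 2) ^ 2) * ‖h‖ ^ q := by positivity
    calc ‖y + h‖ ^ q ≤ ‖y‖ ^ q + q / 2 * (‖y‖ ^ q * t) + (q / 2) ^ 2 * (‖y‖ ^ q * t ^ 2) := by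
          linarith
      _ ≤ ‖y‖ ^ q + q / 2 * (‖y‖ ^ (q - 2) * s)
          + (q / 2) ^ 2 * (‖y‖ ^ (q - 2) * (9 * ‖h‖ ^ 2)) := by rw [hlin]; gcongr
      _ ≤ _ := by rw [hs]; nlinarith

/-- `x` minus its projection to the closed ball of radius `r` around the origin. At `x = 0` the
convention `r / 0 = 0` is harmless because of the factor `x`. -/
noncomputable def overshoot (r : ℝ) (x : E) : E := max 0 (1 - r / ‖x‖) • x

theorem norm_overshoot {r : ℝ} (hr : 0 ≤ r) (x : E) : ‖overshoot r x‖ = max 0 (‖x‖ - r) := by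
  rcases eq_or_ne x 0 with rfl | hx
  · simp [overshoot, hr]
  · have : 0 < ‖x‖ := norm_pos_iff.2 hx
    rw [overshoot, norm_smul, Real.norm_of_nonneg (le_max_left _ _), max_mul_of_nonneg _ _ this.le]
    congr 1
    · simp
    · field_simp

theorem norm_sub_overshoot_le {r : ℝ} (hr : 0 ≤ r) (x : E) : ‖x - overshoot r x‖ ≤ r := by
  rcases eq_or_ne x 0 with rfl | hx
  · simp [overshoot, hr]
  · have hx' : 0 < ‖x‖ := norm_pos_iff.2 hx
    rcases le_total ‖x‖ r with h | h
    · have : 1 - r / ‖x‖ ≤ 0 := by rw [sub_nonpos, one_le_div hx']; exact h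
      simpa [overshoot, max_eq_left this] using h
    · have : 0 ≤ 1 - r / ‖x‖ := by rw [sub_nonneg, div_le_one hx']; exact h
      rw [overshoot, max_eq_right this, sub_smul, one_smul, sub_sub_cancel, norm_smul,
        Real.norm_of_nonneg (by positivity)]
      field_simp; rfl

/-- The distance of `x + h` to the ball is at most its distance to the projection of `x`. This makes
the Taylor bound for powers of the norm available for powers of the distance to the ball. -/
theorem norm_overshoot_add_le {r : ℝ} (hr : 0 ≤ r) (x h : E) :
    ‖overshoot r (x + h)‖ ≤ ‖overshoot r x + h‖ := by
  rw [norm_overshoot hr]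
  refine max_le (norm_nonneg _) ?_
  have h1 : x + h = (x - overshoot r x) + (overshoot r x + h) := by abel
  have h2 := norm_add_le (x - overshoot r x) (overshoot r x + h)
  rw [← h1] at h2
  linarith [norm_sub_overshoot_le hr x]

theorem continuous_norm_overshoot {r : ℝ} (hr : 0 ≤ r) :
    Continuous fun x : E => ‖overshoot r x‖ := by
  simp only [norm_overshoot hr]; fun_prop

variable [CompleteSpace E]

theorem ConcaveOn.sub_le_inner_gradient {l : E → ℝ} (hl : ConcaveOn ℝ Set.univ l)
    (hd : Differentiable ℝ l) (x y : E) : l y - l x ≤ ⟪gradient l x, y - x⟫ := by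
  have hline : ConcaveOn ℝ Set.univ (fun t : ℝ => l (AffineMap.lineMap x y t)) :=
    hl.comp_affineMap (AffineMap.lineMap x y)
  have hder : HasDerivAt (fun t : ℝ => l (AffineMap.lineMap x y t)) ⟪gradient l x, y - x⟫ 0 := by
    have h1 : HasDerivAt (AffineMap.lineMap x y : ℝ → E) (y - x) 0 := AffineMap.hasDerivAt_lineMap
    have h2 : HasFDerivAt l (InnerProductSpace.toDual ℝ E (gradient l x))
        (AffineMap.lineMap x y (0 : ℝ)) := by
      rw [AffineMap.lineMap_apply_zero]
      exact (hd x).hasGradientAt.hasFDerivAt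
    have h3 := h2.comp_hasDerivAt (0 : ℝ) h1
    rw [InnerProductSpace.toDual_apply_apply] at h3
    exact h3
  have := hline.slope_le_of_hasDerivAt (Set.mem_univ 0) (Set.mem_univ 1) one_pos hder
  simpa [slope_def_field] using this

/-- The gradient of a strictly concave function points towards its maximiser, with a component that
is bounded away from zero outside every ball around the maximiser. -/
theorem exists_inner_gradient_le [FiniteDimensional ℝ E] {l : E → ℝ}
    (hl : StrictConcaveOn ℝ Set.univ l) (hd : Differentiable ℝ l) {z : E} (hz : ∀ x, l x ≤ l z)
    {r : ℝ} (hr : 0 < r) :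
    ∃ c, 0 < c ∧ ∀ x, r ≤ ‖x - z‖ → ⟪gradient l x, x - z⟫ ≤ -(c * ‖x - z‖) := by
  have hlt : ∀ x, x ≠ z → l x < l z := fun x hx => by
    refine lt_of_le_of_ne (hz x) fun h => hx ?_
    exact hl.eq_of_isMaxOn (fun y _ => by simpa [h] using hz y) (fun y _ => hz y) trivial trivial
  -- on the sphere of radius `r` the function stays below its maximum by a positive amount
  obtain ⟨δ, hδ, hsphere⟩ : ∃ δ, 0 < δ ∧ ∀ x ∈ Metric.sphere z r, l x ≤ l z - δ := by
    rcases (Metric.sphere z r).eq_empty_or_nonempty with he | hne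
    · exact ⟨1, one_pos, by simp [he]⟩
    · obtain ⟨x₀, hx₀, hmax⟩ :=
        (isCompact_sphere z r).exists_isMaxOn hne hd.continuous.continuousOn
      refine ⟨l z - l x₀, sub_pos.2 (hlt x₀ ?_), fun x hx => ?_⟩
      · rintro rfl; simp at hx₀; exact hr.ne hx₀
      · have : l x ≤ l x₀ := hmax hx
        linarith
  refine ⟨δ / r, by positivity, fun x hx => ?_⟩
  have hD : 0 < ‖x - z‖ := hr.trans_le hx
  -- concavity along the segment from `z` to `x` propagates this amount linearly
  set t : ℝ := r / ‖x - z‖ with ht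
  have ht0 : 0 < t := by positivity
  have ht1 : t ≤ 1 := (div_le_one hD).2 hx
  have hmem : (1 - t) • z + t • x ∈ Metric.sphere z r := by
    have : (1 - t) • z + t • x - z = t • (x - z) := by module
    rw [mem_sphere_iff_norm, this, norm_smul, Real.norm_of_nonneg ht0.le, ht]
    field_simp
  have h1 := hl.concaveOn.2 (Set.mem_univ z) (Set.mem_univ x) (sub_nonneg.2 ht1) ht0.le (by ring)
  have h2 := hsphere _ hmem
  simp only [smul_eq_mul] at h1
  have h3 : δ ≤ t * (l z - l x) := by linarith
  have h4 := hl.concaveOn.sub_le_inner_gradient hd x z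
  have h5 : ⟪gradient l x, z - x⟫ = -⟪gradient l x, x - z⟫ := by
    rw [← inner_neg_right, neg_sub]
  have h6 : δ / r * ‖x - z‖ = δ / t := by rw [ht]; field_simp
  have h7 : δ / t ≤ l z - l x := by rw [div_le_iff₀ ht0]; linarith
  linarith

end Analysis

/-! ### Almost supermartingales and independence of the past -/

section Probability

variable {Ω : Type*} [mΩ : MeasurableSpace Ω] {P : Measure Ω}

/-- The Robbins–Siegmund theorem, for deterministic errors `b`: if `u` decreases by `v` in conditional
mean, up to summable errors, then `u` converges and `v` is summable. The conditional inequality is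
stated through integrals over events of the past. -/
theorem ae_tendsto_and_summable_of_setIntegral_succ_le [IsFiniteMeasure P] {ℱ : Filtration ℕ mΩ}
    {u v : ℕ → Ω → ℝ} {b : ℕ → ℝ} (hu : StronglyAdapted ℱ u) (hv : StronglyAdapted ℱ v)
    (hui : ∀ n, Integrable (u n) P) (hvi : ∀ n, Integrable (v n) P)
    (hu0 : ∀ n ω, 0 ≤ u n ω) (hv0 : ∀ n ω, 0 ≤ v n ω) (hb0 : ∀ n, 0 ≤ b n) (hb : Summable b)
    (h : ∀ n s, MeasurableSet[ℱ n] s →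
      ∫ ω in s, u (n + 1) ω ∂P ≤ ∫ ω in s, (u n ω - v n ω + b n) ∂P) :
    ∀ᵐ ω ∂P, (∃ L, Tendsto (fun n => u n ω) atTop (𝓝 L)) ∧ Summable fun n => v n ω := by
  -- adding the accumulated decrease and subtracting the accumulated error gives a supermartingale
  set S : ℕ → Ω → ℝ := fun n ω =>
    u n ω + (∑ i ∈ Finset.range n, v i ω - ∑ i ∈ Finset.range n, b i) with hS
  have hbB : ∀ n, ∑ i ∈ Finset.range n, b i ≤ ∑' i, b i := fun n =>
    hb.sum_le_tsum _ fun i _ => hb0 i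
  have hRi : ∀ n, Integrable
      (fun ω => ∑ i ∈ Finset.range n, v i ω - ∑ i ∈ Finset.range n, b i) P := fun n =>
    (integrable_finsetSum _ fun i _ => hvi i).sub (integrable_const _)
  have hSi : ∀ n, Integrable (S n) P := fun n => (hui n).add (hRi n)
  have hSsuper : Supermartingale S ℱ P := by
    refine supermartingale_of_setIntegral_succ_le (fun n => ?_) hSi fun n s hs => ?_
    · refine (hu n).add (StronglyMeasurable.sub ?_ stronglyMeasurable_const)
      refine Finset.stronglyMeasurable_fun_sum _ fun i hi => ?_
      exact (hv i).mono (ℱ.mono (Finset.mem_range.1 hi).le)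
    · have hint : Integrable (fun ω => (∑ i ∈ Finset.range n, v i ω - ∑ i ∈ Finset.range n, b i)
          + (v n ω - b n)) P := (hRi n).add ((hvi n).sub (integrable_const _))
      have h1 : ∫ ω in s, S (n + 1) ω ∂P = ∫ ω in s, u (n + 1) ω ∂P
          + ∫ ω in s, ((∑ i ∈ Finset.range n, v i ω - ∑ i ∈ Finset.range n, b i)
            + (v n ω - b n)) ∂P := by
        rw [← integral_add (hui _).integrableOn hint.integrableOn]
        refine integral_congr_ae (ae_of_all _ fun ω => ?_)
        simp only [hS, Finset.sum_range_succ]; ring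
      have h2 : ∫ ω in s, S n ω ∂P = ∫ ω in s, (u n ω - v n ω + b n) ∂P
          + ∫ ω in s, ((∑ i ∈ Finset.range n, v i ω - ∑ i ∈ Finset.range n, b i)
            + (v n ω - b n)) ∂P := by
        have hint' : Integrable (fun ω => u n ω - v n ω + b n) P :=
          ((hui n).sub (hvi n)).add (integrable_const _)
        rw [← integral_add hint'.integrableOn hint.integrableOn]
        refine integral_congr_ae (ae_of_all _ fun ω => ?_)
        simp only [hS]; ring
      rw [h1, h2]
      exact add_le_add (h n s hs) le_rfl
  have hSlow : ∀ n ω, -(∑' i, b i) ≤ S n ω := fun n ω => by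
    have : 0 ≤ ∑ i ∈ Finset.range n, v i ω := Finset.sum_nonneg fun i _ => hv0 i ω
    simp only [hS]
    linarith [hu0 n ω, hbB n]
  have hbdd : ∀ n, eLpNorm ((-S) n) 1 P ≤
      (Real.toNNReal (∫ ω, (S 0 ω + 2 * ∑' i, b i) ∂P) : ℝ≥0) := fun n => by
    rw [Pi.neg_apply, eLpNorm_neg, eLpNorm_one_eq_lintegral_enorm,
      ← ofReal_integral_norm_eq_lintegral_enorm (hSi n)]
    refine ENNReal.ofReal_le_ofReal ?_
    calc ∫ ω, ‖S n ω‖ ∂P ≤ ∫ ω, (S n ω + 2 * ∑' i, b i) ∂P := by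
          refine integral_mono (hSi n).norm ((hSi n).add (integrable_const _)) fun ω => ?_
          have h0 : 0 ≤ ∑' i, b i := tsum_nonneg hb0
          rw [Real.norm_eq_abs, abs_le]
          constructor <;> linarith [hSlow n ω]
      _ ≤ ∫ ω, (S 0 ω + 2 * ∑' i, b i) ∂P := by
          rw [integral_add (hSi n) (integrable_const _), integral_add (hSi 0) (integrable_const _)]
          refine add_le_add ?_ le_rfl
          simpa using hSsuper.setIntegral_le (Nat.zero_le n) MeasurableSet.univ
  filter_upwards [hSsuper.neg.exists_ae_tendsto_of_bdd hbdd] with ω ⟨c, hc⟩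
  have hSc : Tendsto (fun n => S n ω) atTop (𝓝 (-c)) := by simpa using hc.neg
  have hsum : Summable fun n => v n ω := by
    obtain ⟨D, hD⟩ := hSc.bddAbove_range
    refine summable_of_sum_range_le (c := D + ∑' i, b i) (fun n => hv0 n ω) fun n => ?_
    have : S n ω ≤ D := hD ⟨n, rfl⟩
    simp only [hS] at this
    linarith [hu0 n ω, hbB n]
  refine ⟨⟨-c - (∑' i, v i ω - ∑' i, b i), ?_⟩, hsum⟩
  refine (hSc.sub (hsum.hasSum.tendsto_sum_nat.sub hb.hasSum.tendsto_sum_nat)).congr fun n => ?_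
  simp only [hS]; ring

/-- An integral over an event of the past of a function of a past variable `X` and of an independent
variable `w` may be estimated by integrating over `w` first. -/
theorem integrable_and_setIntegral_le_of_indep {Ω : Type*} {m' mΩ : MeasurableSpace Ω}
    {P : Measure Ω} [IsProbabilityMeasure P] {E W : Type*} [MeasurableSpace E] [MeasurableSpace W]
    {ν : Measure W} [IsProbabilityMeasure ν] (hm : m' ≤ mΩ) {X : Ω → E} (hX : Measurable[m'] X)
    {w : Ω → W} (hw : Measurable w) (hlaw : HasLaw w ν P)
    (hind : Indep m' (MeasurableSpace.comap w inferInstance) P)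
    {f : E → W → ℝ} (hf : Measurable (Function.uncurry f)) (hf0 : ∀ x y, 0 ≤ f x y)
    (hfi : ∀ x, Integrable (f x) ν) {k : E → ℝ} (hk : ∀ x, ∫ y, f x y ∂ν ≤ k x)
    (hki : Integrable (fun ω => k (X ω)) P) :
    Integrable (fun ω => f (X ω) (w ω)) P ∧
      ∀ s, MeasurableSet[m'] s → ∫ ω in s, f (X ω) (w ω) ∂P ≤ ∫ ω in s, k (X ω) ∂P := by
  have hX' : Measurable X := hX.mono hm le_rfl
  have hmap : ∀ s, MeasurableSet[m'] s →
      (P.restrict s).map (fun ω => (X ω, w ω)) = ((P.restrict s).map X).prod ν := fun s hs => by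
    refine (Measure.prod_eq fun A B hA hB => ?_).symm
    rw [Measure.map_apply (hX'.prodMk hw) (hA.prod hB), Measure.map_apply hX' hA,
      Measure.restrict_apply (hX'.prodMk hw (hA.prod hB)), Measure.restrict_apply (hX' hA),
      ← hlaw.map_eq, Measure.map_apply hw hB]
    have : (fun ω => (X ω, w ω)) ⁻¹' A ×ˢ B ∩ s = (X ⁻¹' A ∩ s) ∩ w ⁻¹' B := by
      ext ω; simp only [Set.mem_inter_iff, Set.mem_preimage, Set.mem_prod]; tauto
    rw [this]
    exact (Indep_iff _ _ _).1 hind _ _ ((hX hA).inter hs) ⟨B, hB, rfl⟩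
  have hFi : StronglyMeasurable fun x => ∫ y, f x y ∂ν :=
    hf.stronglyMeasurable.integral_prod_right
  have hF0 : ∀ x, 0 ≤ ∫ y, f x y ∂ν := fun x => integral_nonneg (hf0 x)
  have hFint : Integrable (fun ω => ∫ y, f (X ω) y ∂ν) P := by
    refine hki.mono' (hFi.comp_measurable hX').aestronglyMeasurable (ae_of_all _ fun ω => ?_)
    rw [Real.norm_of_nonneg (hF0 _)]
    exact hk _
  have hprod : ∀ s, MeasurableSet[m'] s →
      Integrable (Function.uncurry f) (((P.restrict s).map X).prod ν) := fun s hs => by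
    rw [integrable_prod_iff hf.aestronglyMeasurable]
    refine ⟨ae_of_all _ hfi, ?_⟩
    simp only [Function.uncurry_apply_pair, Real.norm_of_nonneg (hf0 _ _)]
    rw [integrable_map_measure hFi.aestronglyMeasurable hX'.aemeasurable]
    exact hFint.restrict
  constructor
  · have := hprod Set.univ MeasurableSet.univ
    rw [← hmap _ MeasurableSet.univ, Measure.restrict_univ,
      integrable_map_measure hf.aestronglyMeasurable (hX'.prodMk hw).aemeasurable] at this
    exact this
  · intro s hs
    calc ∫ ω in s, f (X ω) (w ω) ∂P
        = ∫ p, Function.uncurry f p ∂(P.restrict s).map (fun ω => (X ω, w ω)) :=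
          (integral_map (hX'.prodMk hw).aemeasurable hf.aestronglyMeasurable).symm
      _ = ∫ x, ∫ y, f x y ∂ν ∂(P.restrict s).map X := by
          rw [hmap s hs, integral_prod _ (hprod s hs)]; rfl
      _ = ∫ ω in s, ∫ y, f (X ω) y ∂ν ∂P :=
          integral_map hX'.aemeasurable hFi.aestronglyMeasurable
      _ ≤ ∫ ω in s, k (X ω) ∂P :=
          integral_mono hFint.restrict hki.restrict fun ω => hk _

theorem ProbabilityTheory.IndepFun.prodMk_left_of_prodMk_right [IsProbabilityMeasure P]
    {A B C : Type*} [MeasurableSpace A] [MeasurableSpace B] [MeasurableSpace C]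
    {a : Ω → A} {b : Ω → B} {c : Ω → C} (ha : Measurable a) (hb : Measurable b) (hc : Measurable c)
    (habc : IndepFun a (fun ω => (b ω, c ω)) P) (hbc : IndepFun b c P) :
    IndepFun (fun ω => (a ω, b ω)) c P := by
  have hab : IndepFun a b P := habc.comp measurable_id measurable_fst
  have := Measure.isProbabilityMeasure_map (μ := P) ha.aemeasurable
  have := Measure.isProbabilityMeasure_map (μ := P) hb.aemeasurable
  have := Measure.isProbabilityMeasure_map (μ := P) hc.aemeasurable
  rw [indepFun_iff_map_prod_eq_prod_map_map (ha.prodMk hb).aemeasurable hc.aemeasurable,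
    hab.map_prod_eq_prod_map_map ha.aemeasurable hb.aemeasurable]
  have h1 := habc.map_prod_eq_prod_map_map ha.aemeasurable (hb.prodMk hc).aemeasurable
  rw [hbc.map_prod_eq_prod_map_map hb.aemeasurable hc.aemeasurable, ← Measure.prodAssoc_prod] at h1
  have h2 := congrArg (Measure.map MeasurableEquiv.prodAssoc.symm) h1
  rw [Measure.map_map (by fun_prop) (by fun_prop), Measure.map_map (by fun_prop) (by fun_prop)] at h2
  simpa [Function.comp_def, MeasurableEquiv.prodAssoc, Equiv.prodAssoc] using h2

end Probability

/-! ### One step of stochastic gradient ascent -/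

section StochasticGradient

open scoped RealInnerProductSpace

variable {E : Type*} [NormedAddCommGroup E] [InnerProductSpace ℝ E] [FiniteDimensional ℝ E]
  [MeasurableSpace E] {W : Type*} [MeasurableSpace W] {ν : Measure W} {l : E → ℝ} {V : E → W → E}
  {q : ℝ}

theorem StochasticOracle.measurable_apply (hV : StochasticOracle l ν V q) (x : E) :
    Measurable (V x) :=
  hV.2.1.comp measurable_prodMk_left

variable [BorelSpace E]

theorem Real.add_rpow_le_two_rpow_mul {a b p : ℝ} (ha : 0 ≤ a) (hb : 0 ≤ b) (hp : 0 ≤ p) :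
    (a + b) ^ p ≤ 2 ^ p * (a ^ p + b ^ p) := by
  have hap : 0 ≤ a ^ p := by positivity
  have hbp : 0 ≤ b ^ p := by positivity
  have key : ∀ c : ℝ, 0 ≤ c → a + b ≤ 2 * c → (a + b) ^ p ≤ 2 ^ p * c ^ p := fun c hc h => by
    rw [← Real.mul_rpow two_pos.le hc]
    exact Real.rpow_le_rpow (by positivity) h hp
  have h2 : (0 : ℝ) ≤ 2 ^ p := by positivity
  rcases le_total a b with h | h
  · have := key b hb (by linarith)
    nlinarith
  · have := key a ha (by linarith)
    nlinarith

theorem Real.rpow_le_one_add_rpow {a p q : ℝ} (ha : 0 ≤ a) (hp : 0 ≤ p) (hpq : p ≤ q) :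
    a ^ p ≤ 1 + a ^ q := by
  have haq : 0 ≤ a ^ q := by positivity
  rcases le_total a 1 with h | h
  · linarith [Real.rpow_le_one ha h hp]
  · linarith [Real.rpow_le_rpow_of_exponent_le h hpq]

theorem StochasticOracle.exists_moment_bound [IsProbabilityMeasure ν]
    (hV : StochasticOracle l ν V q) (hl : LipschitzLogLik l) :
    ∃ K, 0 ≤ K ∧ ∀ x, Integrable (fun w => ‖V x w‖ ^ q) ν ∧ ∫ w, ‖V x w‖ ^ q ∂ν ≤ K := by
  obtain ⟨⟨G, -, hG⟩, hd, -⟩ := hl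
  obtain ⟨hq, -, σ, hσ, hmom⟩ := id hV
  have hgrad : ∀ x, ‖gradient l x‖ ≤ G := fun x => by
    rw [gradient, LinearIsometryEquiv.norm_map]
    exact norm_fderiv_le_of_lipschitz ℝ hG
  refine ⟨2 ^ q * ((G : ℝ) ^ q + σ ^ q), by positivity, fun x => ?_⟩
  obtain ⟨-, hint, hle⟩ := hmom x
  have hpt : ∀ w, ‖V x w‖ ^ q ≤ 2 ^ q * ((G : ℝ) ^ q + ‖V x w - gradient l x‖ ^ q) := fun w => by
    refine le_trans ?_ (Real.add_rpow_le_two_rpow_mul G.2 (norm_nonneg _) (by linarith))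
    refine Real.rpow_le_rpow (norm_nonneg _) ?_ (by linarith)
    have := norm_add_le (gradient l x) (V x w - gradient l x)
    rw [add_sub_cancel] at this
    linarith [hgrad x]
  have hdom : Integrable (fun w => 2 ^ q * ((G : ℝ) ^ q + ‖V x w - gradient l x‖ ^ q)) ν :=
    ((integrable_const _).add hint).const_mul _
  have hi : Integrable (fun w => ‖V x w‖ ^ q) ν := by
    refine hdom.mono' ?_ (ae_of_all _ fun w => ?_)
    · exact ((hV.measurable_apply x).norm.pow_const q).aestronglyMeasurable
    · rw [Real.norm_of_nonneg (by positivity)]; exact hpt w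
  refine ⟨hi, (integral_mono hi hdom hpt).trans ?_⟩
  rw [integral_const_mul, integral_add (integrable_const _) hint]
  simp only [integral_const, probReal_univ, smul_eq_mul, one_mul]
  gcongr

/-- One step of stochastic gradient ascent from `x` decreases the `q`-th power of the distance to a
ball around the maximiser on average, up to an error of the order of the `q`-th power of the step
size. -/
theorem StochasticOracle.exists_integral_norm_overshoot_rpow_le [IsProbabilityMeasure ν]
    (hV : StochasticOracle l ν V q) (hl : LipschitzLogLik l) (hconc : StrictConcaveOn ℝ Set.univ l)
    {z : E} (hz : ∀ x, l x ≤ l z) {r : ℝ} (hr : 0 < r) :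
    ∃ c C : ℝ, 0 < c ∧ 0 ≤ C ∧ ∀ α : ℝ, 0 < α → ∀ x,
      Integrable (fun w => ‖overshoot r (x + α • V x w - z)‖ ^ q) ν ∧
      ∫ w, ‖overshoot r (x + α • V x w - z)‖ ^ q ∂ν ≤
        ‖overshoot r (x - z)‖ ^ q - c * α * ‖overshoot r (x - z)‖ ^ (q - 1) + C * α ^ q := by
  obtain ⟨K, hK, hmom⟩ := hV.exists_moment_bound hl
  have hq := hV.1
  obtain ⟨c, hc, hdrift⟩ := exists_inner_gradient_le hconc hl.2.1 hz hr
  obtain ⟨D, hD, hpow⟩ := exists_norm_add_rpow_le (E := E) hq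
  set B : ℝ := D * (1 + K) with hB
  have hB0 : 0 ≤ B := by positivity
  refine ⟨c, B * (B / c) ^ (q - 2) + D * K, hc, by positivity, fun α hα x => ?_⟩
  set y := overshoot r (x - z) with hy
  have hVi : Integrable (V x) ν := by
    refine (Integrable.add (integrable_const (1 : ℝ)) (hmom x).1).mono'
      (hV.measurable_apply x).aestronglyMeasurable (ae_of_all _ fun w => ?_)
    simpa using Real.rpow_le_one_add_rpow (norm_nonneg (V x w)) zero_le_one (by linarith : 1 ≤ q)
  have hV2le : ∀ w, ‖V x w‖ ^ 2 ≤ 1 + ‖V x w‖ ^ q := fun w => by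
    simpa using Real.rpow_le_one_add_rpow (norm_nonneg (V x w)) zero_le_two hq
  have hV2i : Integrable (fun w => ‖V x w‖ ^ 2) ν := by
    refine (Integrable.add (integrable_const (1 : ℝ)) (hmom x).1).mono'
      ((hV.measurable_apply x).norm.pow_const 2).aestronglyMeasurable (ae_of_all _ fun w => ?_)
    rw [Real.norm_of_nonneg (by positivity)]
    exact hV2le w
  have hV2 : ∫ w, ‖V x w‖ ^ 2 ∂ν ≤ 1 + K := by
    calc ∫ w, ‖V x w‖ ^ 2 ∂ν ≤ ∫ w, (1 + ‖V x w‖ ^ q) ∂ν :=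
          integral_mono hV2i ((integrable_const _).add (hmom x).1) hV2le
      _ ≤ 1 + K := by
          rw [integral_add (integrable_const _) (hmom x).1]
          simpa using (hmom x).2
  have hmean : ∫ w, V x w ∂ν = gradient l x := by
    obtain ⟨-, -, σ, -, h⟩ := hV
    have := (h x).1
    rw [integral_sub hVi (integrable_const _)] at this
    simpa [sub_eq_zero] using this
  have hinner : ⟪y, gradient l x⟫ ≤ -(c * ‖y‖) := by
    rcases le_total r ‖x - z‖ with h | h
    · have h0 : 0 ≤ max 0 (1 - r / ‖x - z‖) := le_max_left _ _
      rw [hy, overshoot, real_inner_smul_left, norm_smul, Real.norm_of_nonneg h0,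
        real_inner_comm]
      nlinarith [mul_le_mul_of_nonneg_left (hdrift x h) h0]
    · have : y = 0 := by
        rw [← norm_eq_zero, hy, norm_overshoot hr.le, max_eq_left (by linarith)]
      simp [this]
  have hpt : ∀ w, ‖overshoot r (x + α • V x w - z)‖ ^ q ≤
      ‖y‖ ^ q + q * ‖y‖ ^ (q - 2) * (α * ⟪y, V x w⟫)
        + D * (‖y‖ ^ (q - 2) * (α ^ 2 * ‖V x w‖ ^ 2) + α ^ q * ‖V x w‖ ^ q) := fun w => by
    have h1 : x + α • V x w - z = (x - z) + α • V x w := by abel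
    have h2 := hpow y (α • V x w)
    rw [real_inner_smul_right, norm_smul, Real.norm_of_nonneg hα.le, mul_pow,
      Real.mul_rpow hα.le (norm_nonneg _)] at h2
    refine le_trans (Real.rpow_le_rpow (norm_nonneg _) ?_ (by linarith)) h2
    rw [h1]
    exact norm_overshoot_add_le hr.le _ _
  have hyV : Integrable (fun w => ⟪y, V x w⟫) ν := hVi.const_inner y
  have hi1 : Integrable (fun w => ‖y‖ ^ q + q * ‖y‖ ^ (q - 2) * (α * ⟪y, V x w⟫)) ν :=
    (integrable_const _).add ((hyV.const_mul _).const_mul _)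
  have hi2 : Integrable (fun w => ‖y‖ ^ (q - 2) * (α ^ 2 * ‖V x w‖ ^ 2) + α ^ q * ‖V x w‖ ^ q) ν :=
    ((hV2i.const_mul _).const_mul _).add ((hmom x).1.const_mul _)
  have hdom : Integrable (fun w => ‖y‖ ^ q + q * ‖y‖ ^ (q - 2) * (α * ⟪y, V x w⟫)
        + D * (‖y‖ ^ (q - 2) * (α ^ 2 * ‖V x w‖ ^ 2) + α ^ q * ‖V x w‖ ^ q)) ν :=
    hi1.add (hi2.const_mul _)
  have hi : Integrable (fun w => ‖overshoot r (x + α • V x w - z)‖ ^ q) ν := by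
    refine hdom.mono' ?_ (ae_of_all _ fun w => ?_)
    · have h1 : Measurable fun w => x + α • V x w - z :=
        (((hV.measurable_apply x).const_smul α).const_add x).sub_const z
      exact (((continuous_norm_overshoot hr.le).measurable.comp h1).pow_const q).aestronglyMeasurable
    · rw [Real.norm_of_nonneg (by positivity)]; exact hpt w
  refine ⟨hi, (integral_mono hi hdom hpt).trans ?_⟩
  have hval : ∫ w, (‖y‖ ^ q + q * ‖y‖ ^ (q - 2) * (α * ⟪y, V x w⟫)
        + D * (‖y‖ ^ (q - 2) * (α ^ 2 * ‖V x w‖ ^ 2) + α ^ q * ‖V x w‖ ^ q)) ∂ν =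
      ‖y‖ ^ q + q * ‖y‖ ^ (q - 2) * (α * ⟪y, gradient l x⟫)
        + D * (‖y‖ ^ (q - 2) * (α ^ 2 * ∫ w, ‖V x w‖ ^ 2 ∂ν) + α ^ q * ∫ w, ‖V x w‖ ^ q ∂ν) := by
    rw [integral_add hi1 (hi2.const_mul _),
      integral_add (integrable_const _) ((hyV.const_mul _).const_mul _), integral_const_mul,
      integral_const_mul, integral_const_mul, integral_inner hVi, hmean,
      integral_add ((hV2i.const_mul _).const_mul _) ((hmom x).1.const_mul _), integral_const_mul,
      integral_const_mul, integral_const_mul]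
    simp
  rw [hval]
  have hg : ‖y‖ ^ (q - 1) = ‖y‖ ^ (q - 2) * ‖y‖ := by
    rw [← Real.rpow_add_one' (norm_nonneg _) (by linarith)]; ring_nf
  have hg2 : 0 ≤ ‖y‖ ^ (q - 2) := by positivity
  have hαq : 0 < α ^ q := by positivity
  -- the second order term is absorbed by the drift, unless `‖y‖` is of the order of `α`
  have hyoung : B * (‖y‖ ^ (q - 2) * α ^ 2) ≤
      c * α * ‖y‖ ^ (q - 1) + B * (B / c) ^ (q - 2) * α ^ q := by
    rcases le_total (B * α) (c * ‖y‖) with h | h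
    · have h0 : 0 ≤ B * (B / c) ^ (q - 2) * α ^ q := by positivity
      rw [hg]
      nlinarith [mul_le_mul_of_nonneg_left h (by positivity : 0 ≤ ‖y‖ ^ (q - 2) * α)]
    · have h1 : ‖y‖ ≤ B / c * α := by
        rw [div_mul_eq_mul_div, le_div_iff₀ hc]; linarith
      have h2 : ‖y‖ ^ (q - 2) ≤ (B / c) ^ (q - 2) * α ^ (q - 2) := by
        rw [← Real.mul_rpow (by positivity) hα.le]
        exact Real.rpow_le_rpow (norm_nonneg _) h1 (by linarith)
      have h3 : α ^ q = α ^ (q - 2) * α ^ 2 := by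
        rw [← Real.rpow_natCast α 2, ← Real.rpow_add hα]; congr 1; push_cast; ring
      have h4 : 0 ≤ c * α * ‖y‖ ^ (q - 1) := by positivity
      calc B * (‖y‖ ^ (q - 2) * α ^ 2) ≤ B * ((B / c) ^ (q - 2) * α ^ (q - 2) * α ^ 2) := by gcongr
        _ = B * (B / c) ^ (q - 2) * α ^ q := by rw [h3]; ring
        _ ≤ _ := by linarith
  have hdr : q * ‖y‖ ^ (q - 2) * (α * ⟪y, gradient l x⟫) ≤ -(2 * (c * α * ‖y‖ ^ (q - 1))) := by
    rw [hg]
    have h1 := mul_le_mul_of_nonneg_left hinner (by positivity : 0 ≤ q * ‖y‖ ^ (q - 2) * α)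
    have h2 : 0 ≤ c * α * (‖y‖ ^ (q - 2) * ‖y‖) := by positivity
    nlinarith
  have hsec : D * (‖y‖ ^ (q - 2) * (α ^ 2 * ∫ w, ‖V x w‖ ^ 2 ∂ν) + α ^ q * ∫ w, ‖V x w‖ ^ q ∂ν) ≤
      D * (‖y‖ ^ (q - 2) * (α ^ 2 * (1 + K)) + α ^ q * K) := by
    gcongr
    exact (hmom x).2
  have : D * (‖y‖ ^ (q - 2) * (α ^ 2 * (1 + K)) + α ^ q * K) =
      B * (‖y‖ ^ (q - 2) * α ^ 2) + D * K * α ^ q := by rw [hB]; ring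
  linarith

end StochasticGradient

/-! ### Almost sure convergence of stochastic gradient ascent -/

section StochasticGradientConvergence

variable {E : Type*} [NormedAddCommGroup E] [InnerProductSpace ℝ E] [FiniteDimensional ℝ E]
  [MeasurableSpace E] [BorelSpace E] {W : Type*} [MeasurableSpace W] {ν : Measure W}
  {l : E → ℝ} {V : E → W → E} {q : ℝ} {Ω : Type*} [mΩ : MeasurableSpace Ω] {P : Measure Ω}
  {α : ℕ → ℝ}

/-- A nonzero limit of `g ^ q` would bound `g` away from zero, so that the summability of `a * g ^ s`
would make the weights `a` summable. -/
theorem tendsto_zero_of_tendsto_of_summable_mul_rpow {a g : ℕ → ℝ} {q s L : ℝ} (hq : 0 < q)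
    (hs : 0 < s) (ha0 : ∀ n, 0 ≤ a n) (ha : ¬ Summable a) (hg : ∀ n, 0 ≤ g n)
    (hL : Tendsto (fun n => g n ^ q) atTop (𝓝 L)) (hsum : Summable fun n => a n * g n ^ s) :
    Tendsto g atTop (𝓝 0) := by
  have hgL : Tendsto g atTop (𝓝 (L ^ q⁻¹)) := by
    refine (hL.rpow_const (Or.inr (by positivity : 0 ≤ q⁻¹))).congr fun n => ?_
    rw [← Real.rpow_mul (hg n), mul_inv_cancel₀ hq.ne', Real.rpow_one]
  rcases (ge_of_tendsto' hgL hg).eq_or_lt with h0 | h0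
  · rwa [← h0] at hgL
  · refine absurd ?_ ha
    set δ := L ^ q⁻¹ / 2 with hδ
    have hδ0 : 0 < δ := by positivity
    have hev : ∀ᶠ n in atTop, δ ≤ g n :=
      (hgL.eventually (lt_mem_nhds (half_lt_self h0))).mono fun n hn => hn.le
    obtain ⟨N, hN⟩ := eventually_atTop.1 hev
    rw [← summable_nat_add_iff N] at hsum ⊢
    refine Summable.of_nonneg_of_le (fun n => ha0 _) (fun n => ?_) (hsum.mul_left (δ ^ s)⁻¹)
    have h1 : δ ^ s ≤ g (n + N) ^ s :=
      Real.rpow_le_rpow hδ0.le (hN _ (Nat.le_add_left N n)) hs.le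
    have h2 : 0 < δ ^ s := by positivity
    rw [inv_mul_eq_div, le_div_iff₀ h2]
    exact mul_le_mul_of_nonneg_left h1 (ha0 _)

/-- Almost sure convergence of stochastic gradient ascent from a bounded starting point. The `q`-th
powers of the step sizes, but not necessarily their squares, have to be summable. -/
theorem StochasticOracle.ae_tendsto_of_adapted [IsProbabilityMeasure ν] [IsProbabilityMeasure P]
    (hV : StochasticOracle l ν V q) (hl : LipschitzLogLik l) (hconc : StrictConcaveOn ℝ Set.univ l)
    {z : E} (hz : ∀ x, l x ≤ l z) (hα : ∀ n, 0 < α (n + 1))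
    (hαq : Summable fun n => α (n + 1) ^ q) (hα1 : ¬ Summable fun n => α (n + 1))
    {ℱ : Filtration ℕ mΩ} {w : ℕ → Ω → W} (hw : ∀ n, Measurable (w n))
    (hlaw : ∀ n, HasLaw (w n) ν P)
    (hind : ∀ n, Indep (ℱ n) (MeasurableSpace.comap (w (n + 1)) inferInstance) P)
    {X : ℕ → Ω → E} (hX : ∀ n, Measurable[ℱ n] (X n))
    (hstep : ∀ n ω, X (n + 1) ω = X n ω + α (n + 1) • V (X n ω) (w (n + 1) ω))
    {R : ℝ} (hR : ∀ ω, ‖X 0 ω‖ ≤ R) :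
    ∀ᵐ ω ∂P, Tendsto (fun n => X n ω) atTop (𝓝 z) := by
  have hq := hV.1
  -- `overshoot r (x - z)` is used with every radius `r`, since its drift constant depends on `r`
  have key : ∀ r : ℝ, 0 < r →
      ∀ᵐ ω ∂P, Tendsto (fun n => ‖overshoot r (X n ω - z)‖) atTop (𝓝 0) := fun r hr => by
    obtain ⟨c, C, hc, hC, hone⟩ := hV.exists_integral_norm_overshoot_rpow_le hl hconc hz hr
    set g : E → ℝ := fun x => ‖overshoot r (x - z)‖ with hg
    have hg0 : ∀ x, 0 ≤ g x := fun x => norm_nonneg _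
    have hgm : Measurable g :=
      ((continuous_norm_overshoot hr.le).comp (continuous_id.sub continuous_const)).measurable
    have hX' : ∀ n, Measurable (X n) := fun n => (hX n).mono (ℱ.le n) le_rfl
    have hv_of_hu : ∀ n, Integrable (fun ω => g (X n ω) ^ q) P →
        Integrable (fun ω => c * α (n + 1) * g (X n ω) ^ (q - 1)) P := fun n hn => by
      refine Integrable.const_mul ?_ _
      refine (Integrable.add (integrable_const (1 : ℝ)) hn).mono'
        ((hgm.comp (hX' n)).pow_const _).aestronglyMeasurable (ae_of_all _ fun ω => ?_)
      rw [Real.norm_of_nonneg (Real.rpow_nonneg (hg0 _) _)]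
      exact Real.rpow_le_one_add_rpow (hg0 _) (by linarith) (by linarith)
    have hfm : ∀ n, Measurable (Function.uncurry fun x y => g (x + α (n + 1) • V x y) ^ q) :=
      fun n => (hgm.comp (measurable_fst.add (hV.2.1.const_smul (α (n + 1))))).pow_const q
    have hcond : ∀ n, Integrable (fun ω => g (X n ω) ^ q) P →
        Integrable (fun ω => g (X (n + 1) ω) ^ q) P ∧ ∀ s, MeasurableSet[ℱ n] s →
          ∫ ω in s, g (X (n + 1) ω) ^ q ∂P ≤ ∫ ω in s, (g (X n ω) ^ q
            - c * α (n + 1) * g (X n ω) ^ (q - 1) + C * α (n + 1) ^ q) ∂P := fun n hn => by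
      have := integrable_and_setIntegral_le_of_indep (ℱ.le n) (hX n) (hw (n + 1)) (hlaw (n + 1))
        (hind n) (hfm n) (fun x y => Real.rpow_nonneg (hg0 _) _)
        (fun x => (hone _ (hα n) x).1) (fun x => (hone _ (hα n) x).2)
        ((hn.sub (hv_of_hu n hn)).add (integrable_const _))
      simpa only [hstep] using this
    have hui : ∀ n, Integrable (fun ω => g (X n ω) ^ q) P := fun n => by
      induction n with
      | zero =>
        refine (integrable_const ((R + ‖z‖) ^ q)).mono'
          ((hgm.comp (hX' 0)).pow_const _).aestronglyMeasurable (ae_of_all _ fun ω => ?_)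
        rw [Real.norm_of_nonneg (Real.rpow_nonneg (hg0 _) _)]
        refine Real.rpow_le_rpow (hg0 _) ?_ (by linarith)
        rw [hg]
        simp only [norm_overshoot hr.le]
        have := norm_sub_le (X 0 ω) z
        refine max_le ?_ ?_ <;> linarith [hR ω, norm_nonneg (X 0 ω), norm_nonneg z]
      | succ n ih => exact (hcond n ih).1
    have hadapt : ∀ (s : ℝ) n, StronglyMeasurable[ℱ n] fun ω => g (X n ω) ^ s := fun s n =>
      ((hgm.comp (hX n)).pow_const s).stronglyMeasurable
    have hRS := ae_tendsto_and_summable_of_setIntegral_succ_le (ℱ := ℱ)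
      (u := fun n ω => g (X n ω) ^ q) (v := fun n ω => c * α (n + 1) * g (X n ω) ^ (q - 1))
      (b := fun n => C * α (n + 1) ^ q) (hadapt q) (fun n => (hadapt (q - 1) n).const_mul _) hui
      (fun n => hv_of_hu n (hui n)) (fun n ω => Real.rpow_nonneg (hg0 _) _)
      (fun n ω => mul_nonneg (mul_nonneg hc.le (hα n).le) (Real.rpow_nonneg (hg0 _) _))
      (fun n => mul_nonneg hC (Real.rpow_nonneg (hα n).le _)) (hαq.mul_left C)
      fun n => (hcond n (hui n)).2
    filter_upwards [hRS] with ω ⟨⟨L, hL⟩, hsum⟩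
    refine tendsto_zero_of_tendsto_of_summable_mul_rpow (a := fun n => c * α (n + 1))
      (by linarith : 0 < q) (by linarith : 0 < q - 1) (fun n => mul_nonneg hc.le (hα n).le) ?_
      (fun n => hg0 _) hL hsum
    rwa [summable_mul_left_iff hc.ne']
  have hall : ∀ᵐ ω ∂P, ∀ k : ℕ,
      Tendsto (fun n => ‖overshoot (1 / ((k : ℝ) + 1)) (X n ω - z)‖) atTop (𝓝 0) :=
    ae_all_iff.2 fun k => key _ (by positivity)
  filter_upwards [hall] with ω hω
  rw [tendsto_iff_norm_sub_tendsto_zero, Metric.tendsto_atTop]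
  intro ε hε
  obtain ⟨k, hk⟩ := exists_nat_one_div_lt (half_pos hε)
  obtain ⟨N, hN⟩ := Metric.tendsto_atTop.1 (hω k) (ε / 2) (half_pos hε)
  refine ⟨N, fun n hn => ?_⟩
  have h1 := hN n hn
  rw [dist_zero_right, norm_norm, norm_overshoot (by positivity)] at h1
  rw [dist_zero_right, norm_norm]
  linarith [le_max_right 0 (‖X n ω - z‖ - 1 / ((k : ℝ) + 1))]

theorem bsgd_add {E W : Type*} [AddCommGroup E] [Module ℝ E] (α : ℕ → ℝ) (V : E → W → E)
    (w : ℕ → W) (τ : ℕ) (θ : E) (j k : ℕ) :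
    bsgd α V w (τ + j) (bsgd α V w τ θ j) k = bsgd α V w τ θ (j + k) := by
  induction k with
  | zero => rfl
  | succ k ih => rw [bsgd, ih, ← add_assoc, bsgd]; simp only [add_assoc]

/-- Almost sure convergence of stochastic gradient ascent with i.i.d. oracle calls. -/
theorem StochasticOracle.ae_tendsto_bsgd [IsProbabilityMeasure ν] [IsProbabilityMeasure P]
    (hV : StochasticOracle l ν V q) (hl : LipschitzLogLik l) (hconc : StrictConcaveOn ℝ Set.univ l)
    {z : E} (hz : ∀ x, l x ≤ l z) (hα : ∀ n, 0 < α (n + 1))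
    (hαq : Summable fun n => α (n + 1) ^ q) (hα1 : ¬ Summable fun n => α (n + 1))
    {w : ℕ → Ω → W} (hw : ∀ n, Measurable (w n)) (hlaw : ∀ n, HasLaw (w n) ν P)
    (hwi : iIndepFun w P) {θ : Ω → E} (hθ : Measurable θ)
    (hθw : IndepFun θ (fun ω n => w n ω) P) :
    ∀ᵐ ω ∂P, Tendsto (fun n => bsgd α V (fun n => w n ω) 0 (θ ω) n) atTop (𝓝 z) := by
  -- the starting point is replaced by `0` where it is outside a ball of radius `k`
  have key : ∀ k : ℕ, ∀ᵐ ω ∂P, Tendsto (fun n => bsgd α V (fun n => w n ω) 0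
      ((Metric.closedBall (0 : E) k).indicator id (θ ω)) n) atTop (𝓝 z) := fun k => by
    set φ : E → E := (Metric.closedBall (0 : E) k).indicator id with hφ
    have hφm : Measurable φ := measurable_id.indicator Metric.isClosed_closedBall.measurableSet
    set past : (n : ℕ) → Ω → E × (Finset.range (n + 1) → W) :=
      fun n ω => (φ (θ ω), fun i => w i ω) with hpast
    have hpastm : ∀ n, Measurable (past n) := fun n =>
      (hφm.comp hθ).prodMk (measurable_pi_lambda _ fun i => hw i)
    let ℱ : Filtration ℕ mΩ :=
      { seq := fun n => MeasurableSpace.comap (past n) inferInstance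
        mono' := fun i j hij => by
          have hsub : ∀ a : Finset.range (i + 1), (a : ℕ) ∈ Finset.range (j + 1) := fun a =>
            Finset.mem_range.2 ((Finset.mem_range.1 a.2).trans_le (by omega))
          have hfac : past i = (fun p : E × (Finset.range (j + 1) → W) =>
              (p.1, fun a : Finset.range (i + 1) => p.2 ⟨a, hsub a⟩)) ∘ past j := rfl
          have hm : Measurable (fun p : E × (Finset.range (j + 1) → W) =>
              (p.1, fun a : Finset.range (i + 1) => p.2 ⟨a, hsub a⟩)) :=
            measurable_fst.prodMk
              (measurable_pi_lambda _ fun a => (measurable_pi_apply _).comp measurable_snd)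
          show MeasurableSpace.comap (past i) _ ≤ MeasurableSpace.comap (past j) _
          rw [hfac, ← MeasurableSpace.comap_comp]
          exact MeasurableSpace.comap_mono hm.comap_le
        le' := fun n => (hpastm n).comap_le }
    have hpastℱ : ∀ n, Measurable[ℱ n] (past n) := fun n => comap_measurable _
    have hwℱ : ∀ n, Measurable[ℱ n] (w n) := fun n =>
      (measurable_pi_apply (⟨n, Finset.self_mem_range_succ n⟩ : Finset.range (n + 1))).comp
        (measurable_snd.comp (hpastℱ n))
    have hind : ∀ n, Indep (ℱ n) (MeasurableSpace.comap (w (n + 1)) inferInstance) P := fun n => by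
      have h1 : IndepFun (fun ω (i : Finset.range (n + 1)) => w i ω) (w (n + 1)) P :=
        (hwi.indepFun_finset (Finset.range (n + 1)) {n + 1} (by simp) hw).comp measurable_id
          (measurable_pi_apply (⟨n + 1, Finset.mem_singleton_self _⟩ : ({n + 1} : Finset ℕ)))
      have hm : Measurable fun p : ℕ → W =>
          ((fun i : Finset.range (n + 1) => p i), p (n + 1)) :=
        (measurable_pi_lambda _ fun i => measurable_pi_apply _).prodMk (measurable_pi_apply _)
      exact IndepFun.prodMk_left_of_prodMk_right (hφm.comp hθ)
        (measurable_pi_lambda _ fun i => hw i) (hw _) (hθw.comp hφm hm) h1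
    have hX : ∀ n, Measurable[ℱ n] fun ω => bsgd α V (fun n => w n ω) 0 (φ (θ ω)) n := fun n => by
      induction n with
      | zero => exact measurable_fst.comp (hpastℱ 0)
      | succ n ih =>
        have h1 := ih.mono (ℱ.mono n.le_succ) le_rfl
        simp only [bsgd, zero_add]
        exact h1.add ((hV.2.1.comp (h1.prodMk (hwℱ (n + 1)))).const_smul _)
    refine hV.ae_tendsto_of_adapted hl hconc hz hα hαq hα1 hw hlaw hind hX (R := k)
      (fun n ω => by simp only [bsgd, zero_add]) fun ω => ?_
    by_cases h : θ ω ∈ Metric.closedBall (0 : E) k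
    · simpa only [bsgd, hφ, Set.indicator_of_mem h, id, mem_closedBall_zero_iff] using h
    · simp [bsgd, hφ, Set.indicator_of_notMem h]
  filter_upwards [ae_all_iff.2 key] with ω hω
  obtain ⟨k, hk⟩ := exists_nat_ge ‖θ ω‖
  have := hω k
  rwa [Set.indicator_of_mem (by simpa using hk), id] at this

theorem not_summable_of_isTheta_rpow {l : ℝ} (hl : l ≤ 1)
    (h : α =Θ[atTop] fun τ : ℕ => 1 / (τ : ℝ) ^ l) : ¬ Summable fun n => α (n + 1) := by
  rw [summable_nat_add_iff 1]
  intro hs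
  exact absurd (Real.summable_one_div_nat_rpow.1 (summable_of_isBigO_nat hs h.2)) hl.not_gt

theorem summable_rpow_of_isTheta_rpow {l q : ℝ} (hq : 0 ≤ q) (hlq : 1 < l * q)
    (h : α =Θ[atTop] fun τ : ℕ => 1 / (τ : ℝ) ^ l) :
    Summable fun n => α (n + 1) ^ q := by
  rw [summable_nat_add_iff 1 (f := fun n => α n ^ q)]
  refine summable_of_isBigO_nat (Real.summable_one_div_nat_rpow.2 hlq) ?_
  have h1 := h.1.rpow hq (Eventually.of_forall fun n => by positivity)
  refine h1.congr' (Eventually.of_forall fun n => rfl) (Eventually.of_forall fun n => ?_)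
  simp only
  rw [Real.div_rpow zero_le_one (by positivity), Real.one_rpow, ← Real.rpow_mul (by positivity)]

end StochasticGradientConvergence

/-! ### Events that occur infinitely often -/

section Visits

theorem condExp_inter_of_indep {Ω : Type*} {m₁ m₂ mB mΩ : MeasurableSpace Ω} {P : Measure Ω}
    [IsProbabilityMeasure P] (h₁₂ : m₁ ≤ m₂) (h₂ : m₂ ≤ mΩ) (hBΩ : mB ≤ mΩ) (hind : Indep m₂ mB P)
    {A B : Set Ω} (hA : MeasurableSet[m₂] A) (hB : MeasurableSet[mB] B) :
    P⟦A ∩ B | m₁⟧ =ᵐ[P] fun ω => P.real B * (P⟦A | m₁⟧) ω := by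
  have h₁ : m₁ ≤ mΩ := h₁₂.trans h₂
  have hA' : MeasurableSet A := h₂ A hA
  have hB' : MeasurableSet B := hBΩ B hB
  refine (ae_eq_condExp_of_forall_setIntegral_eq h₁
    ((integrable_const (1 : ℝ)).indicator (hA'.inter hB'))
    (fun s _ _ => (integrable_condExp.const_mul _).integrableOn) (fun s hs _ => ?_)
    (stronglyMeasurable_condExp.const_mul _).aestronglyMeasurable).symm
  rw [integral_const_mul, setIntegral_condExp h₁ ((integrable_const (1 : ℝ)).indicator hA') hs,
    setIntegral_indicator hA', setIntegral_indicator (hA'.inter hB'), setIntegral_const,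
    setIntegral_const, smul_eq_mul, smul_eq_mul, mul_one, mul_one, ← Set.inter_assoc]
  have := (Indep_iff _ _ _).1 hind (s ∩ A) B ((h₁₂ s hs).inter hA) hB
  simp only [measureReal_def, this, ENNReal.toReal_mul]
  ring

theorem stdGaussian_real_norm_smul_le_pos {n : ℕ} (c : ℝ) {δ : ℝ} (hδ : 0 < δ) :
    0 < (stdGaussian (EuclideanSpace ℝ (Fin n))).real {x | ‖c • x‖ ≤ δ} := by
  have h1 : (gaussianReal 0 1).IsOpenPosMeasure :=
    (gaussianReal_absolutelyContinuous' 0 one_ne_zero).isOpenPosMeasure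
  have h2 : (stdGaussian (EuclideanSpace ℝ (Fin n))).IsOpenPosMeasure := by
    rw [← map_pi_eq_stdGaussian]
    exact Continuous.isOpenPosMeasure_map (PiLp.continuous_toLp 2 _) (WithLp.toLp_surjective 2)
  have hopen : IsOpen {x : EuclideanSpace ℝ (Fin n) | ‖c • x‖ < δ} :=
    isOpen_lt (by fun_prop) continuous_const
  refine ENNReal.toReal_pos (ne_of_gt ?_) (measure_ne_top _ _)
  refine (hopen.measure_pos _ ⟨0, by simpa using hδ⟩).trans_le (measure_mono fun x hx => ?_)
  have hx' : ‖c • x‖ < δ := hx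
  exact hx'.le

variable {M : Type*} [Fintype M] [DecidableEq M] {𝓜 : ModelClass M} {W : M → Type*}
  [∀ m, MeasurableSpace (W m)] {ν : ∀ m, Measure (W m)} {ι : Type*} [Fintype ι]
  {A : Algorithm 𝓜 W ι} {Ω : Type*} [mΩ : MeasurableSpace Ω] {P : Measure Ω}
  [IsProbabilityMeasure P] {𝓕 : Filtration ℕ mΩ} {𝓖 : ℕ → MeasurableSpace Ω} {I : Inputs 𝓜 W ι Ω}

/-- Every model is proposed infinitely often by a kernel that is positive everywhere, jointly with
events that do not depend on the history and the proposal and have probabilities bounded away from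
zero. -/
theorem Algorithm.IsRun.ae_frequently_proposal (h : A.IsRun I ν P 𝓕 𝓖) {r : ι}
    (hr : 0 < A.weight r) (hk : ∀ m m', 0 < A.kernel r m m') (m : M) {B : ℕ → Set Ω}
    {mB : ℕ → MeasurableSpace Ω} (hBF : ∀ s, mB s ≤ 𝓕 (s + 1)) (hind : ∀ s, Indep (𝓖 s) (mB s) P)
    (hB : ∀ s, MeasurableSet[mB s] (B s)) {β : ℝ} (hβ : 0 < β) (hβB : ∀ s, β ≤ P.real (B s)) :
    ∀ᵐ ω ∂P, ∃ᶠ s in atTop, I.kernelIdx s ω = r ∧ I.proposal s ω = m ∧ ω ∈ B s := by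
  have : Nonempty M := ⟨m⟩
  obtain ⟨m₀, hm₀⟩ := Finite.exists_min fun m' => A.kernel r m' m
  set γ : ℝ := β * (A.weight r * A.kernel r m₀ m) with hγ
  have hγ0 : 0 < γ := mul_pos hβ (mul_pos hr (hk m₀ m))
  let D : ℕ → Set Ω := fun s => {ω | I.kernelIdx s ω = r ∧ I.proposal s ω = m}
  have hD : ∀ s, MeasurableSet[𝓖 s] (D s) := fun s =>
    (h.measurable_kernelIdx s r).inter (h.measurable_proposal s m)
  -- the events of iteration `s + 1` belong to `𝓕 (s + 1)`, hence the shift of the index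
  let S : ℕ → Set Ω := fun n => n.casesOn ∅ fun s => D s ∩ B s
  have hS : ∀ n, MeasurableSet[𝓕 n] (S n) := fun n => by
    cases n with
    | zero => exact @MeasurableSet.empty Ω (𝓕 0)
    | succ s => exact (h.𝓖_le s _ (hD s)).inter (hBF s _ (hB s))
  have hcond : ∀ᵐ ω ∂P, ∀ s, γ ≤ (P[(S (s + 1)).indicator (1 : Ω → ℝ) | 𝓕 s]) ω := by
    refine ae_all_iff.2 fun s => ?_
    filter_upwards [condExp_inter_of_indep (h.le_𝓖 s) ((h.𝓖_le s).trans (𝓕.le _))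
      ((hBF s).trans (𝓕.le _)) (hind s) (hD s) (hB s), h.proposal_law s r m] with ω h1 h2
    refine le_of_le_of_eq ?_ h1.symm
    rw [h2, hγ]
    have h3 := mul_le_mul_of_nonneg_left (hm₀ (A.run I s ω).current) hr.le
    exact mul_le_mul (hβB s) h3 (mul_pos hr (hk m₀ m)).le measureReal_nonneg
  filter_upwards [ae_mem_limsup_atTop_iff P hS, hcond] with ω hω hc
  have hmem : ω ∈ limsup S atTop := by
    refine hω.2 (tendsto_atTop_mono (fun n => ?_)
      (tendsto_natCast_atTop_atTop.atTop_mul_const hγ0))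
    calc (n : ℝ) * γ = ∑ _k ∈ Finset.range n, γ := by simp
      _ ≤ _ := Finset.sum_le_sum fun k _ => hc k
  rw [mem_limsup_iff_frequently_mem, frequently_atTop] at hmem
  refine frequently_atTop.2 fun a => ?_
  obtain ⟨n, hn, hnS⟩ := hmem (a + 1)
  obtain ⟨s, rfl⟩ : ∃ s, n = s + 1 := ⟨n - 1, by omega⟩
  exact ⟨s, by omega, hnS.1.1, hnS.1.2, hnS.2⟩

/-- Whether or not the outcome is randomised, infinitely many visits have a small noise vector. -/
theorem Algorithm.IsRun.ae_frequently_noise (h : A.IsRun I ν P 𝓕 𝓖) {r : ι}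
    (hr : 0 < A.weight r) (hk : ∀ m m', 0 < A.kernel r m m') (m : M) {δ : ℝ} (hδ : 0 < δ) :
    ∀ᵐ ω ∂P, ∃ᶠ s in atTop,
      I.proposal s ω = m ∧ ‖(A.sdRand : ℝ) • I.noise s m ω‖ ≤ δ := by
  have hset : MeasurableSet {x : 𝓜.Param m | ‖(A.sdRand : ℝ) • x‖ ≤ δ} :=
    measurableSet_le (by fun_prop) measurable_const
  have := h.ae_frequently_proposal hr hk m
    (B := fun s => {ω | ‖(A.sdRand : ℝ) • I.noise s m ω‖ ≤ δ})
    (mB := fun s => MeasurableSpace.comap (I.noise s m) inferInstance)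
    (fun s => (h.measurable_noise s m).comap_le)
    (fun s => indep_of_indep_of_le_right ((h.aux_indep s).indep (i := 0) (j := 2) (by decide))
      (by
        have : I.noise s m = (fun x : ∀ m, 𝓜.Param m => x m) ∘ fun ω m => I.noise s m ω := rfl
        rw [this, ← MeasurableSpace.comap_comp]
        exact MeasurableSpace.comap_mono (measurable_pi_apply m).comap_le))
    (fun s => ⟨_, hset, rfl⟩) (stdGaussian_real_norm_smul_le_pos (A.sdRand : ℝ) hδ)
    (fun s => ((h.noise_law s m).measureReal_eq hset).ge)
  filter_upwards [this] with ω hω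
  exact hω.mono fun s hs => ⟨hs.2.1, hs.2.2⟩

theorem Algorithm.IsRun.ae_frequently_unif (h : A.IsRun I ν P 𝓕 𝓖) {r : ι}
    (hr : 0 < A.weight r) (hk : ∀ m m', 0 < A.kernel r m m') (m : M) {c : ℝ} (hc : 0 < c)
    (hc1 : c ≤ 1) :
    ∀ᵐ ω ∂P, ∃ᶠ s in atTop, I.kernelIdx s ω = r ∧ I.proposal s ω = m ∧ I.unif s ω ≤ c := by
  have hvol : (volume.restrict (Set.Icc (0 : ℝ) 1)).real {x | x ≤ c} = c := by
    have hm : MeasurableSet {x : ℝ | x ≤ c} := measurableSet_Iic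
    rw [measureReal_restrict_apply hm]
    have : {x : ℝ | x ≤ c} ∩ Set.Icc 0 1 = Set.Icc 0 c := by
      ext x; simp only [Set.mem_inter_iff, Set.mem_ofPred_eq, Set.mem_Icc]
      constructor
      · rintro ⟨h1, h2, -⟩; exact ⟨h2, h1⟩
      · rintro ⟨h1, h2⟩; exact ⟨h2, h1, h2.trans hc1⟩
    rw [this, Real.volume_real_Icc_of_le hc.le, sub_zero]
  exact h.ae_frequently_proposal hr hk m (B := fun s => {ω | I.unif s ω ≤ c})
    (mB := fun s => MeasurableSpace.comap (I.unif s) inferInstance)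
    (fun s => (h.measurable_unif s).comap_le)
    (fun s => (h.aux_indep s).indep (i := 0) (j := 3) (by decide))
    (fun s => ⟨Set.Iic c, measurableSet_Iic, rfl⟩) hc
    (fun s => (hvol.symm.trans ((h.unif_law s).measureReal_eq measurableSet_Iic).symm).le)

end Visits

/-! ### Pathwise properties of the algorithm -/

section Trajectories

variable {M : Type*} [Fintype M]

theorem ModelClass.plugIn_pos (𝓜 : ModelClass M) (m : M) (θ : 𝓜.Param m) : 0 < 𝓜.plugIn m θ :=
  Real.exp_pos _

theorem ModelClass.laplace_pos (𝓜 : ModelClass M) (m : M) : 0 < 𝓜.laplace m :=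
  𝓜.plugIn_pos m _

theorem ModelClass.plugIn_le_laplace (𝓜 : ModelClass M) {m : M}
    (h : ∀ θ, 𝓜.logLik m θ ≤ 𝓜.logLik m (𝓜.mle m)) (θ : 𝓜.Param m) :
    𝓜.plugIn m θ ≤ 𝓜.laplace m :=
  Real.exp_le_exp.2 (sub_le_sub_right (h θ) _)

theorem ModelClass.exp_mul_plugIn_le (𝓜 : ModelClass M) {m : M} {G : ℝ≥0}
    (hG : LipschitzWith G (𝓜.logLik m)) (θ η : 𝓜.Param m) {δ : ℝ} (hη : ‖η‖ ≤ δ) :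
    Real.exp (-(G * δ)) * 𝓜.plugIn m θ ≤ 𝓜.plugIn m (θ + η) := by
  rw [ModelClass.plugIn, ModelClass.plugIn, ← Real.exp_add, Real.exp_le_exp]
  have h1 := hG.dist_le_mul θ (θ + η)
  rw [dist_self_add_right, Real.dist_eq] at h1
  have h2 : (G : ℝ) * ‖η‖ ≤ G * δ := by gcongr
  linarith [le_abs_self (𝓜.logLik m θ - 𝓜.logLik m (θ + η))]

theorem ModelClass.pL_eq_laplace (𝓜 : ModelClass M) {available : Set M}
    (h : ∀ m ∈ available, 𝓜.marginal m = 𝓜.laplace m) (m : M) :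
    𝓜.pL available m = 𝓜.laplace m := by
  unfold ModelClass.pL
  split_ifs with hm
  · exact h m hm
  · rfl

variable [DecidableEq M] {𝓜 : ModelClass M} {W : M → Type*} {ι : Type*} {Ω : Type*}

namespace Algorithm

variable (I : Inputs 𝓜 W ι Ω) (ω : Ω)

theorem evaluated_mono : Monotone fun t => evaluated I t ω := fun _ _ h =>
  Finset.image_subset_image (Finset.range_mono h)

theorem exists_mem_evaluated {m : M} (h : ∃ᶠ s in atTop, I.proposal s ω = m) :
    ∃ t, m ∈ evaluated I t ω := by
  obtain ⟨s, hs⟩ := h.exists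
  exact ⟨s + 1, Finset.mem_image.2 ⟨s, Finset.self_mem_range_succ s, hs⟩⟩

variable [Fintype ι] (A : Algorithm 𝓜 W ι)

/-- The points at which the runs for one model end lie on a single trajectory of stochastic gradient
ascent. -/
theorem run_param_eq_bsgd (m : M) (s : ℕ) :
    (A.run I s ω).param m = bsgd (A.stepSize m) (A.oracle m) (fun τ => I.seed m τ ω) 0
      (I.initParam m ω) ((A.run I s ω).count m) := by
  induction s with
  | zero => rfl
  | succ s ih =>
    rcases eq_or_ne m (I.proposal s ω) with rfl | hne
    · have h := bsgd_add (A.stepSize (I.proposal s ω)) (A.oracle (I.proposal s ω))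
        (fun τ => I.seed (I.proposal s ω) τ ω) 0 (I.initParam (I.proposal s ω) ω)
        ((A.run I s ω).count (I.proposal s ω)) (I.iters s ω)
      rw [zero_add] at h
      simp only [run, step, Function.update_self, bsgdResult, ih, h]
    · simpa only [run, step, Function.update_of_ne hne] using ih

theorem run_count_mono (m : M) : Monotone fun s => (A.run I s ω).count m := by
  refine monotone_nat_of_le_succ fun s => ?_
  rcases eq_or_ne m (I.proposal s ω) with rfl | hne
  · simp only [run, step, Function.update_self]; omega
  · simp only [run, step, Function.update_of_ne hne]; rfl

theorem tendsto_run_count (m : M) (hiter : ∀ s, 1 ≤ I.iters s ω)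
    (hfreq : ∃ᶠ s in atTop, I.proposal s ω = m) :
    Tendsto (fun s => (A.run I s ω).count m) atTop atTop := by
  refine tendsto_atTop_atTop_of_monotone (A.run_count_mono I ω m) fun b => ?_
  induction b with
  | zero => exact ⟨0, Nat.zero_le _⟩
  | succ b ih =>
    obtain ⟨s, hs⟩ := ih
    obtain ⟨t, hst, rfl⟩ := frequently_atTop.1 hfreq s
    have h1 := A.run_count_mono I ω (I.proposal t ω) hst
    have h2 := hiter t
    refine ⟨t + 1, ?_⟩
    simp only [run, step, Function.update_self] at h1 ⊢
    omega

theorem run_popt_mono (m : M) : Monotone fun s => (A.run I s ω).popt m := by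
  refine monotone_nat_of_le_succ fun s => ?_
  rcases eq_or_ne m (I.proposal s ω) with rfl | hne
  · simp only [run, step, newPopt, Function.update_self]; exact le_max_left _ _
  · simp only [run, step, newPopt, Function.update_of_ne hne]; rfl

theorem eps_le_run_popt (m : M) (s : ℕ) : A.eps ≤ (A.run I s ω).popt m :=
  A.run_popt_mono I ω m (Nat.zero_le s)

theorem run_popt_le_laplace (hmle : ∀ m θ, 𝓜.logLik m θ ≤ 𝓜.logLik m (𝓜.mle m))
    (heps : ∀ m, A.eps ≤ 𝓜.laplace m) (m : M) (s : ℕ) :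
    (A.run I s ω).popt m ≤ 𝓜.laplace m := by
  induction s with
  | zero => exact heps m
  | succ s ih =>
    rcases eq_or_ne m (I.proposal s ω) with rfl | hne
    · simp only [run, step, newPopt, Function.update_self]
      exact max_le ih (𝓜.plugIn_le_laplace (hmle _) _)
    · simpa only [run, step, newPopt, Function.update_of_ne hne] using ih

/-- At a visit with a small randomisation the estimate is at least the plug-in value of the gradient
ascent, up to a factor close to one. -/
theorem exp_mul_plugIn_le_run_popt {s : ℕ} {m : M} {G : ℝ≥0}
    (hG : LipschitzWith G (𝓜.logLik m)) {δ : ℝ} (hδ : 0 ≤ δ) (hm : I.proposal s ω = m)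
    (hnoise : ‖(A.sdRand : ℝ) • I.noise s m ω‖ ≤ δ) :
    Real.exp (-(G * δ)) * 𝓜.plugIn m ((A.run I (s + 1) ω).param m) ≤
      (A.run I (s + 1) ω).popt m := by
  subst hm
  simp only [run, step, newPopt, Function.update_self]
  refine le_trans ?_ (le_max_right _ _)
  rw [evalPoint]
  split_ifs
  · exact 𝓜.exp_mul_plugIn_le hG _ _ hnoise
  · simpa using 𝓜.exp_mul_plugIn_le hG (A.bsgdResult I s ω (A.run I s ω)) 0
      (by simpa using hδ : ‖(0 : 𝓜.Param (I.proposal s ω))‖ ≤ δ)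

theorem tendsto_run_popt (hmle : ∀ m θ, 𝓜.logLik m θ ≤ 𝓜.logLik m (𝓜.mle m))
    (heps : ∀ m, A.eps ≤ 𝓜.laplace m) {m : M} {G : ℝ≥0} (hG : LipschitzWith G (𝓜.logLik m))
    (hparam : Tendsto (fun s => (A.run I s ω).param m) atTop (𝓝 (𝓜.mle m)))
    (hfreq : ∀ k : ℕ, ∃ᶠ s in atTop, I.proposal s ω = m ∧
      ‖(A.sdRand : ℝ) • I.noise s m ω‖ ≤ 1 / ((k : ℝ) + 1)) :
    Tendsto (fun s => (A.run I s ω).popt m) atTop (𝓝 (𝓜.laplace m)) := by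
  have hbdd : BddAbove (Set.range fun s => (A.run I s ω).popt m) := by
    refine ⟨𝓜.laplace m, ?_⟩
    rintro _ ⟨s, rfl⟩
    exact A.run_popt_le_laplace I ω hmle heps m s
  have hlim := tendsto_atTop_ciSup (A.run_popt_mono I ω m) hbdd
  set L := ⨆ s, (A.run I s ω).popt m
  have hle : L ≤ 𝓜.laplace m :=
    le_of_tendsto' hlim fun s => A.run_popt_le_laplace I ω hmle heps m s
  have hplug : Tendsto (fun s => 𝓜.plugIn m ((A.run I (s + 1) ω).param m)) atTop
      (𝓝 (𝓜.laplace m)) := by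
    have hc : Continuous (𝓜.plugIn m) :=
      Real.continuous_exp.comp (hG.continuous.sub continuous_const)
    exact (hc.tendsto _).comp (hparam.comp (tendsto_add_atTop_nat 1))
  have hk : ∀ k : ℕ, Real.exp (-(G * (1 / ((k : ℝ) + 1)))) * 𝓜.laplace m ≤ L := fun k => by
    by_contra! hlt
    have hev := (hplug.const_mul (Real.exp (-(G * (1 / ((k : ℝ) + 1)))))).eventually
      (lt_mem_nhds hlt)
    obtain ⟨s, ⟨hs, hn⟩, hs'⟩ := ((hfreq k).and_eventually hev).exists
    have h1 := A.exp_mul_plugIn_le_run_popt I ω hG (by positivity) hs hn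
    exact absurd (h1.trans (le_ciSup hbdd (s + 1))) hs'.not_ge
  have hge : 𝓜.laplace m ≤ L := by
    have h0 : Tendsto (fun k : ℕ => Real.exp (-(G * (1 / ((k : ℝ) + 1)))) * 𝓜.laplace m) atTop
        (𝓝 (Real.exp (-(G * 0)) * 𝓜.laplace m)) := by
      refine Tendsto.mul_const _ ((Real.continuous_exp.tendsto _).comp ?_)
      exact (tendsto_one_div_add_atTop_nhds_zero_nat.const_mul (G : ℝ)).neg
    simp only [mul_zero, neg_zero, Real.exp_zero, one_mul] at h0
    exact le_of_tendsto' h0 hk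
  rwa [← le_antisymm hle hge]

/-- Since the estimates stay between two positive bounds, so do the acceptance probabilities. -/
theorem exists_le_acceptProb (heps0 : 0 < A.eps)
    (hmle : ∀ m θ, 𝓜.logLik m θ ≤ 𝓜.logLik m (𝓜.mle m)) (heps : ∀ m, A.eps ≤ 𝓜.laplace m)
    {r : ι} (hk : ∀ m m', 0 < A.kernel r m m') (m : M) :
    ∃ c, 0 < c ∧ c ≤ 1 ∧ ∀ s ω m', c ≤ A.acceptProb (A.run I s ω).popt r m' m := by
  have : Nonempty M := ⟨m⟩
  let c : M → ℝ := fun m' => min 1 ((A.eps * 𝓜.modelPrior m * A.kernel r m m') /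
    (𝓜.laplace m' * 𝓜.modelPrior m' * A.kernel r m' m))
  obtain ⟨m₀, hm₀⟩ := Finite.exists_min c
  have hp := 𝓜.modelPrior_pos
  refine ⟨c m₀, ?_, min_le_left _ _, fun s ω m' => (hm₀ m').trans ?_⟩
  · have h1 := 𝓜.laplace_pos m₀
    exact lt_min one_pos (div_pos (mul_pos (mul_pos heps0 (hp m)) (hk m m₀))
      (mul_pos (mul_pos h1 (hp m₀)) (hk m₀ m)))
  · have h1 : 0 < (A.run I s ω).popt m' := heps0.trans_le (A.eps_le_run_popt I ω m' s)
    have h2 := A.run_popt_le_laplace I ω hmle heps m' s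
    have h3 := A.eps_le_run_popt I ω m s
    have h3' := heps0.trans_le h3
    have h4 := hp m
    have h5 := hp m'
    have h6 := hk m m'
    have h7 := hk m' m
    refine min_le_min_left 1 ?_
    gcongr

/-- A proposal is accepted for certain if the uniform variable is below the lower bound of the
acceptance probabilities. -/
theorem exists_mem_occupied {r : ι} {m : M} {c : ℝ}
    (hc : ∀ s m', c ≤ A.acceptProb (A.run I s ω).popt r m' m)
    (h : ∃ᶠ s in atTop, I.kernelIdx s ω = r ∧ I.proposal s ω = m ∧ I.unif s ω ≤ c) :
    ∃ t, m ∈ A.occupied I t ω := by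
  obtain ⟨s, hr, hm, hu⟩ := h.exists
  refine ⟨s + 1, Finset.mem_image.2 ⟨s + 1, Finset.mem_Icc.2 ⟨by omega, le_rfl⟩, ?_⟩⟩
  subst hm hr
  exact if_pos (hu.trans (hc (s + 1) _))

theorem occupied_mono : Monotone fun t => A.occupied I t ω := fun _ _ h =>
  Finset.image_subset_image (Finset.Icc_subset_Icc_right h)

end Algorithm

/-- Once every model has been visited, the renormalised estimates are continuous functions of the
estimates of the marginal likelihoods. -/
theorem ModelClass.tendsto_renormalised {p : ℕ → M → ℝ} {p' : M → ℝ} {V : ℕ → Finset M}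
    (hp : ∀ m, Tendsto (fun t => p t m) atTop (𝓝 (p' m))) (hp' : ∀ m, 0 < p' m)
    (hV : Monotone V) (hmem : ∀ m, ∃ t, m ∈ V t) (m : M) :
    Tendsto (fun t => 𝓜.renormalised (p t) (V t) m) atTop
      (𝓝 (p' m * 𝓜.modelPrior m / ∑ m', p' m' * 𝓜.modelPrior m')) := by
  have huniv : ∀ᶠ t in atTop, V t = Finset.univ := by
    have : ∀ᶠ t in atTop, ∀ m, m ∈ V t := eventually_all.2 fun m => by
      obtain ⟨t, ht⟩ := hmem m
      exact (eventually_ge_atTop t).mono fun t' h => hV h ht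
    exact this.mono fun t ht => Finset.eq_univ_of_forall ht
  have hsum : ∑ m', p' m' * 𝓜.modelPrior m' ≠ 0 :=
    (Finset.sum_pos (fun m' _ => mul_pos (hp' m') (𝓜.modelPrior_pos m'))
      ⟨m, Finset.mem_univ m⟩).ne'
  refine (((hp m).mul_const _).div (tendsto_finsetSum _ fun m' _ => (hp m').mul_const _)
    hsum).congr' ?_
  filter_upwards [huniv] with t ht
  simp [renormalised, ht]

end Trajectories

/-! ### Convergence of the algorithm -/

section Convergence

/-- For every model the points at which its runs end converge to the maximum likelihood estimate. -/
theorem Algorithm.IsRun.ae_tendsto_run_param {M : Type*} [Fintype M] [DecidableEq M]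
    {𝓜 : ModelClass M} {W : M → Type*} [∀ m, MeasurableSpace (W m)] {ν : ∀ m, Measure (W m)}
    [∀ m, IsProbabilityMeasure (ν m)] {ι : Type*} [Fintype ι] {A : Algorithm 𝓜 W ι} {Ω : Type*}
    [mΩ : MeasurableSpace Ω] {P : Measure Ω} [IsProbabilityMeasure P] {𝓕 : Filtration ℕ mΩ}
    {𝓖 : ℕ → MeasurableSpace Ω} {I : Inputs 𝓜 W ι Ω} (h : A.IsRun I ν P 𝓕 𝓖) {m : M} {q l : ℝ}
    (hl : 2 / (q + 2) < l ∧ l ≤ 1) (hstep : A.stepSize m =Θ[atTop] fun τ : ℕ => 1 / (τ : ℝ) ^ l)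
    (hlip : LipschitzLogLik (𝓜.logLik m)) (hconc : StrictlyConcaveLogLik (𝓜.logLik m))
    (hmle : ∀ θ, 𝓜.logLik m θ ≤ 𝓜.logLik m (𝓜.mle m))
    (hV : StochasticOracle (𝓜.logLik m) (ν m) (A.oracle m) q)
    (hfreq : ∀ᵐ ω ∂P, ∃ᶠ s in atTop, I.proposal s ω = m) :
    ∀ᵐ ω ∂P, Tendsto (fun s => (A.run I s ω).param m) atTop (𝓝 (𝓜.mle m)) := by
  have hq := hV.1
  have hlq : 1 < l * q := by
    have h1 := hl.1
    rw [div_lt_iff₀ (by linarith)] at h1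
    nlinarith
  filter_upwards [hfreq, hV.ae_tendsto_bsgd hlip hconc hmle
    (fun n => A.stepSize_pos m (n + 1) (Nat.le_add_left 1 n))
    (summable_rpow_of_isTheta_rpow (by linarith) hlq hstep)
    (not_summable_of_isTheta_rpow hl.2 hstep) (h.measurable_seed m) (h.seed_law m) (h.seed_indep m)
    ((h.measurable_initParam m).mono (𝓕.le 0) le_rfl) (h.seed_indep_initParam m)] with ω h1 h2
  refine (h2.comp (A.tendsto_run_count I ω m (fun s => h.one_le_iters s ω) h1)).congr fun s => ?_
  exact (A.run_param_eq_bsgd I ω m s).symm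

end Convergence

theorem mainTheorem1 {M : Type*} [Fintype M] [DecidableEq M] (𝓜 : ModelClass M)
    {W : M → Type*} [∀ m, MeasurableSpace (W m)] (ν : ∀ m, Measure (W m))
    [∀ m, IsProbabilityMeasure (ν m)]
    {ι : Type*} [Fintype ι] (A : Algorithm 𝓜 W ι)
    -- one kernel of the mixture can propose every model from every model
    (h_kernel : ∃ r, 0 < A.weight r ∧ ∀ m m', 0 < A.kernel r m m')
    -- the initial estimate is positive and at most the smallest Laplace approximation
    (h_eps_pos : 0 < A.eps) (h_eps_le : ∀ m, A.eps ≤ 𝓜.laplace m)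
    -- step sizes
    (q l : M → ℝ) (h_l : ∀ m, 2 / (q m + 2) < l m ∧ l m ≤ 1)
    (h_step : ∀ m, A.stepSize m =Θ[atTop] fun τ : ℕ => 1 / (τ : ℝ) ^ l m)
    -- conditions on the likelihoods and on the gradient oracles
    (h_cond1 : ∀ m, LipschitzLogLik (𝓜.logLik m))
    (h_cond2 : ∀ m, StrictlyConcaveLogLik (𝓜.logLik m))
    (h_cond3 : ∀ m, CoerciveLogLik (𝓜.logLik m))
    (h_cond4 : ∀ m, AsymptoticallyFlatLogLik (𝓜.logLik m))
    (h_cond5 : ∀ m, StochasticOracle (𝓜.logLik m) (ν m) (A.oracle m) (q m))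
    -- where the exact marginal likelihood is the target, the Laplace approximation is exact
    (available : Set M) (h_exact : ∀ m ∈ available, 𝓜.marginal m = 𝓜.laplace m)
    -- a run of the algorithm
    {Ω : Type*} [mΩ : MeasurableSpace Ω] (P : Measure Ω) [IsProbabilityMeasure P]
    (𝓕 : Filtration ℕ mΩ) (𝓖 : ℕ → MeasurableSpace Ω) (I : Inputs 𝓜 W ι Ω)
    (h_run : A.IsRun I ν P 𝓕 𝓖) (m : M) :
    (∀ᵐ ω ∂P, Tendsto (fun t => (A.run I t ω).popt m) atTop (𝓝 (𝓜.pL available m))) ∧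
    (∀ᵐ ω ∂P, Tendsto
      (fun t => 𝓜.renormalised (A.run I t ω).popt (A.occupied I t ω) m)
      atTop (𝓝 (𝓜.target available m))) ∧
    (∀ᵐ ω ∂P, Tendsto
      (fun t => 𝓜.renormalised (A.run I t ω).popt (Algorithm.evaluated I t ω) m)
      atTop (𝓝 (𝓜.target available m))) := by
  obtain ⟨r, hr, hk⟩ := h_kernel
  have hmle : ∀ m θ, 𝓜.logLik m θ ≤ 𝓜.logLik m (𝓜.mle m) := fun m θ =>
    𝓜.logLik_le_logLik_mle m (h_cond1 m) (h_cond3 m) θ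
  have hnoise : ∀ᵐ ω ∂P, ∀ m, ∀ k : ℕ, ∃ᶠ s in atTop, I.proposal s ω = m ∧
      ‖(A.sdRand : ℝ) • I.noise s m ω‖ ≤ 1 / ((k : ℝ) + 1) :=
    ae_all_iff.2 fun m => ae_all_iff.2 fun k => h_run.ae_frequently_noise hr hk m (by positivity)
  have hprop : ∀ᵐ ω ∂P, ∀ m, ∃ᶠ s in atTop, I.proposal s ω = m := by
    filter_upwards [hnoise] with ω hω m
    exact (hω m 0).mono fun s hs => hs.1
  have hparam : ∀ᵐ ω ∂P, ∀ m, Tendsto (fun s => (A.run I s ω).param m) atTop (𝓝 (𝓜.mle m)) :=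
    ae_all_iff.2 fun m => h_run.ae_tendsto_run_param (h_l m) (h_step m) (h_cond1 m) (h_cond2 m)
      (hmle m) (h_cond5 m) (hprop.mono fun ω hω => hω m)
  have hpopt : ∀ᵐ ω ∂P, ∀ m,
      Tendsto (fun t => (A.run I t ω).popt m) atTop (𝓝 (𝓜.pL available m)) := by
    filter_upwards [hnoise, hparam] with ω h1 h2 m
    obtain ⟨⟨G, -, hG⟩, -⟩ := h_cond1 m
    rw [𝓜.pL_eq_laplace h_exact]
    exact A.tendsto_run_popt I ω hmle h_eps_le hG (h2 m) (h1 m)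
  -- occupation needs acceptance too, and a uniform variable below the bound `c` guarantees it
  have hocc : ∀ᵐ ω ∂P, ∀ m, ∃ t, m ∈ A.occupied I t ω := by
    refine ae_all_iff.2 fun m => ?_
    obtain ⟨c, hc0, hc1, hc⟩ := A.exists_le_acceptProb I h_eps_pos hmle h_eps_le hk m
    filter_upwards [h_run.ae_frequently_unif hr hk m hc0 hc1] with ω hω
    exact A.exists_mem_occupied I ω (fun s => hc s ω) hω
  have hpos : ∀ m, 0 < 𝓜.pL available m := fun m => by
    rw [𝓜.pL_eq_laplace h_exact]; exact 𝓜.laplace_pos m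
  refine ⟨hpopt.mono fun ω hω => hω m, ?_, ?_⟩
  · filter_upwards [hpopt, hocc] with ω h1 h2
    exact 𝓜.tendsto_renormalised h1 hpos (A.occupied_mono I ω) h2 m
  · filter_upwards [hpopt, hprop] with ω h1 h2
    exact 𝓜.tendsto_renormalised h1 hpos (Algorithm.evaluated_mono I ω)
      (fun m' => Algorithm.exists_mem_evaluated I ω (h2 m')) m
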